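/- Let $\mathcal H$ be a real Hilbert space (of any, possibly infinite, dimension), $\mathcal W\subseteq\mathcal H$ a convex set with $\|\mathbf w\|\le R$ for all $\mathbf w\in\mathcal W$ ($R>0$), and let $\mathbb D$ be a probability distribution on $\mathcal H\times\mathbb R$ such that $\|\mathbf x\|\le D$ for almost every $(\mathbf x,y)\sim\mathbb D$. Let $\ell:\mathbb R\times\mathbb R\to\mathbb R$ be a loss such that, for almost every $(\mathbf x,y)\sim\mathbb D$, $\ell(\cdot,y)$ coincides on $[-DR,DR]$ with a nonnegative $\beta$-smooth function on $\mathbb R$ (differentiable with $\beta$-Lipschitz derivative; $\beta\ge 0$), and write $\ell'(\cdot,y)$ for its derivative. Let $r:\mathcal W\to\mathbb R$ satisfy $|r(\mathbf w)-r(\mathbf w')|\le P\|\mathbf w-\mathbf w'\|$ on $\mathcal W$ ($P\ge0$). Put $$H(\mathbf w)=\mathrm E_{(\mathbf x,y)\sim\mathbb D}[\ell(\langle\mathbf w,\mathbf x\rangle,y)],\qquad F(\mathbf w)=H(\mathbf w)+r(\mathbf w),\qquad \widehat F(\mathbf w)=\frac1n\sum_{i=1}^n\ell(\langle\mathbf w,\mathbf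 x_i\rangle,y_i)+r(\mathbf w),$$ where $(\mathbf x_1,y_1),\dots,(\mathbf x_n,y_n)$, $n\ge1$, are drawn independently from $\mathbb D$ and $H$ is finite on $\mathcal W$. Assume that $F$ is $\lambda$-strongly convex on $\mathcal W$ ($\lambda>0$; $F$ need not be differentiable) and that $\widehat F$ is almost surely convex on $\mathcal W$. Let $\mathbf w_*\in\arg\min_{\mathbf w\in\mathcal W}F(\mathbf w)$, $L=\beta D^2$, $\kappa=L/\lambda$, and for $0<\delta<1$ let $$M=\operatorname*{ess\,sup}_{(\mathbf x,y)\sim\mathbb D}\|\ell'(\langle\mathbf w_*,\mathbf x\rangle,y)\,\mathbf x\|<\infty,\qquad C=4\left(8+\sqrt{2\log\frac{\lceil 2\log_2 n+\log_2(2R)\rceil}{\delta}}\right),\qquad H_*=H(\mathbf w_*).$$ (If $2Rn^2\le1$ the ceiling is nonpositive, and the square root is then immaterial: the bounds hold with any real value in its place.) Then with probability at least $1-2\delta$ every $\widehat{\mathbf w}\in\arg\min_{\mathbf w\in\mathcal W}\widehat F(\mathbf w)$ satisfies $$F(\widehat{\mathbf w})-F(\mathbf w_*)\le\max\left(\frac{M+P}{n^2}+\frac{L}{2n^4},\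 \frac{4R^2L^2C^2}{\lambda n}+\frac{4RM\log(2/\delta)}{n}+\frac{8LH_*\log(2/\delta)}{\lambda n}\right).$$ Furthermore, if $n\ge16\kappa^2C^2$, then with probability at least $1-2\delta$ every $\widehat{\mathbf w}\in\arg\min_{\mathbf w\in\mathcal W}\widehat F(\mathbf w)$ satisfies $$F(\widehat{\mathbf w})-F(\mathbf w_*)\le\max\left(\frac{M+P}{n^2}+\frac{L}{2n^4},\ \frac{8M^2\log^2(2/\delta)}{\lambda n^2}+\frac{16LH_*\log(2/\delta)}{\lambda n}\right).$$ -/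

import Mathlib

open MeasureTheory
open scoped ENNReal

noncomputable section

/-- `f` coincides on `[-a, a]` with a nonnegative `β`-smooth function on the real line
(differentiable, with `β`-Lipschitz derivative). -/
def IsNonnegSmoothOn (β a : ℝ) (f : ℝ → ℝ) : Prop :=
  ∃ g : ℝ → ℝ, (∀ u, 0 ≤ g u) ∧ Differentiable ℝ g ∧
    (∀ u v, |deriv g u - deriv g v| ≤ β * |u - v|) ∧
    ∀ u ∈ Set.Icc (-a) a, f u = g u

section Risk

variable {E : Type*} [NormedAddCommGroup E] [InnerProductSpace ℝ E]

/-- The loss `ℓ(⟨w, x⟩, y)` of the linear predictor `w` on the example `z = (x, y)`. -/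
def linLoss (ℓ : ℝ → ℝ → ℝ) (w : E) (z : E × ℝ) : ℝ :=
  ℓ (inner ℝ w z.1) z.2

/-- The gradient in `w` of `ℓ(⟨w, x⟩, y)`, that is `ℓ'(⟨w, x⟩, y) x`, where `ℓ'` is the derivative
of `ℓ(·, y)` over `[-a, a]` (one-sided at the endpoints). -/
def linLossGrad (ℓ : ℝ → ℝ → ℝ) (a : ℝ) (w : E) (z : E × ℝ) : E :=
  derivWithin (fun u => ℓ u z.2) (Set.Icc (-a) a) (inner ℝ w z.1) • z.1

/-- `H(w)`, the expected loss. -/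
def expLoss [MeasurableSpace E] (ℓ : ℝ → ℝ → ℝ) (μ : Measure (E × ℝ)) (w : E) : ℝ :=
  ∫ z, linLoss ℓ w z ∂μ

/-- The empirical loss over the sample `S`. -/
def empLoss (ℓ : ℝ → ℝ → ℝ) {n : ℕ} (S : Fin n → E × ℝ) (w : E) : ℝ :=
  (1 / (n : ℝ)) * ∑ i, linLoss ℓ w (S i)

/-- `F(w)`, the regularized expected loss. -/
def risk [MeasurableSpace E] (ℓ : ℝ → ℝ → ℝ) (r : E → ℝ) (μ : Measure (E × ℝ)) (w : E) : ℝ :=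
  expLoss ℓ μ w + r w

/-- The regularized empirical loss over the sample `S`. -/
def empRisk (ℓ : ℝ → ℝ → ℝ) (r : E → ℝ) {n : ℕ} (S : Fin n → E × ℝ) (w : E) : ℝ :=
  empLoss ℓ S w + r w

end Risk

/-- `4 (8 + √(2 log (⌈2 log₂ n + log₂ (2R)⌉ / δ)))`. -/
def complexityConst (n : ℕ) (R δ : ℝ) : ℝ :=
  4 * (8 + Real.sqrt (2 * Real.log
    ((⌈2 * Real.logb 2 (n : ℝ) + Real.logb 2 (2 * R)⌉ : ℝ) / δ)))

/-- The event `A` contains a measurable event of probability at least `p`. -/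
def WithProbAtLeast {Ω : Type*} [MeasurableSpace Ω] (P : Measure Ω) (p : ℝ) (A : Set Ω) : Prop :=
  ∃ B : Set Ω, MeasurableSet B ∧ B ⊆ A ∧ ENNReal.ofReal p ≤ P B

end

/-! Write `a` for the minimizer of `F`, `b` for one of the empirical objective, and `d = ‖b - a‖`.
The regularizer cancels in the difference of the two objectives, so that difference is smooth
although `r` need not be. Moving from `b` towards `a` and using strong convexity gives
(`StrongConvexOn.sub_add_le_inner`) that `F b - F a + λ/2 d²` is at most the inner product of `b -
a` with the gradient error (expected minus empirical) at `b`.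

That error splits into the error at `a` and the change of the error from `a` to `b`. At `a`, a
Bernstein inequality in Hilbert space (`measure_lt_norm_sum_le`) applies; its variance is small
because a nonnegative smooth loss satisfies `‖∇f‖² ≤ 2 L f`, which is how `H_*` enters. The change,
paired with `b - a`, is a Lipschitz function of `⟨b, x⟩`. Symmetrization, contraction and bounded
differences (`measure_exists_lt_sum_le`) control it uniformly on a ball, and peeling over dyadic
radii makes the bound proportional to `d²`.

What remains is a quadratic inequality in `d`, solved in two ways (`le_of_add_half_sq_le`,
`le_of_add_half_sq_le_of_le`). Peeling stops at radius `1/n²`; below it, smoothness of `H` at `a`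
and the Lipschitz bound on `r` give the first term of the maximum. -/

/-! ### A second-order bound for `cosh ‖·‖` in a Hilbert space. -/

/-- The power series of `cosh √s` in `s` has nonnegative coefficients, so it is a sum of convex
functions. -/
lemma Real.convexOn_cosh_sqrt : ConvexOn ℝ (Set.Ici 0) fun s : ℝ => Real.cosh (Real.sqrt s) := by
  have hs : ∀ s : ℝ, 0 ≤ s →
      HasSum (fun n : ℕ => s ^ n / ((2 * n).factorial : ℝ)) (Real.cosh (Real.sqrt s)) := by
    intro s hs
    have h := Real.hasSum_cosh (Real.sqrt s)
    simpa only [pow_mul, Real.sq_sqrt hs] using h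
  refine ⟨convex_Ici 0, fun x hx y hy a b ha hb hab => ?_⟩
  have hx' : 0 ≤ x := hx
  have hy' : 0 ≤ y := hy
  refine hasSum_le (fun n => ?_) (hs (a • x + b • y) (by simp only [smul_eq_mul]; positivity))
    (((hs x hx').const_smul a).add ((hs y hy').const_smul b))
  have := (convexOn_pow n).2 hx hy ha hb hab
  simp only [smul_eq_mul] at this ⊢
  rw [← mul_div_assoc, ← mul_div_assoc, ← add_div]
  gcongr

lemma Real.exp_sub_one_sub_le_sq_div {b : ℝ} (hb : 0 ≤ b) (hb1 : b < 1) :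
    Real.exp b - 1 - b ≤ b ^ 2 / (1 - b) := by
  have h := Real.exp_bound_div_one_sub_of_interval hb hb1
  have h1 : (1 - b) ≠ 0 := by linarith
  have : 1 / (1 - b) - 1 - b = b ^ 2 / (1 - b) := by field_simp; ring
  linarith

section InnerProduct

variable {E : Type*} [NormedAddCommGroup E] [InnerProductSpace ℝ E]

/-- `‖x + h‖²` is a convex combination, with weight `θ`, of `(‖x‖ + ‖h‖)²` and `(‖x‖ - ‖h‖)²`, so
convexity of `cosh √s` reduces the claim to the line. The middle term is linear in `h` and vanishes
in mean when `h` is centered. -/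
lemma cosh_norm_add_le (x h : E) :
    Real.cosh ‖x + h‖ ≤ Real.cosh ‖x‖ + Real.sinh ‖x‖ / ‖x‖ * inner ℝ x h +
      Real.cosh ‖x‖ * (Real.exp ‖h‖ - 1 - ‖h‖) := by
  have ha := norm_nonneg x
  have hb := norm_nonneg h
  obtain ⟨θ, h0, h1, hp⟩ : ∃ θ : ℝ, 0 ≤ θ ∧ θ ≤ 1 ∧
      inner ℝ x h = (2 * θ - 1) * (‖x‖ * ‖h‖) := by
    have hle := abs_le.1 (abs_real_inner_le_norm x h)
    rcases (mul_nonneg ha hb).eq_or_lt with h0 | hpos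
    · refine ⟨0, le_rfl, zero_le_one, ?_⟩
      rw [← h0] at hle ⊢
      linarith [hle.1, hle.2]
    · refine ⟨(1 + inner ℝ x h / (‖x‖ * ‖h‖)) / 2, ?_, ?_, ?_⟩
      · have : -1 ≤ inner ℝ x h / (‖x‖ * ‖h‖) := by rw [le_div_iff₀ hpos]; linarith [hle.1]
        linarith
      · have : inner ℝ x h / (‖x‖ * ‖h‖) ≤ 1 := by rw [div_le_one hpos]; exact hle.2
        linarith
      · have := hpos.ne'
        generalize ‖x‖ * ‖h‖ = c at *
        field_simp
        ring
  have hsq : ‖x + h‖ ^ 2 = θ * (‖x‖ + ‖h‖) ^ 2 + (1 - θ) * (‖x‖ - ‖h‖) ^ 2 := by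
    rw [norm_add_sq_real, hp]; ring
  have hconv := Real.convexOn_cosh_sqrt.2 (Set.mem_Ici.2 (sq_nonneg (‖x‖ + ‖h‖)))
    (Set.mem_Ici.2 (sq_nonneg (‖x‖ - ‖h‖))) h0 (sub_nonneg.2 h1) (by ring)
  simp only [smul_eq_mul] at hconv
  rw [← hsq, Real.sqrt_sq (norm_nonneg _), Real.sqrt_sq_eq_abs, Real.sqrt_sq_eq_abs,
    Real.cosh_abs, Real.cosh_abs, Real.cosh_add, Real.cosh_sub] at hconv
  -- For `x = 0` the quotient is `0` by convention, and both sides vanish.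
  have hdiv : Real.sinh ‖x‖ / ‖x‖ * inner ℝ x h = Real.sinh ‖x‖ * ((2 * θ - 1) * ‖h‖) := by
    rw [hp]
    rcases ha.eq_or_lt with h0 | hpos
    · rw [← h0]; simp
    · field_simp
  rw [hdiv, ← Real.cosh_add_sinh ‖h‖]
  refine hconv.trans ?_
  have hs : 0 ≤ Real.sinh ‖x‖ := Real.sinh_nonneg_iff.2 ha
  have hsc : Real.sinh ‖x‖ ≤ Real.cosh ‖x‖ := (Real.sinh_lt_cosh _).le
  have hb' : 0 ≤ Real.sinh ‖h‖ - ‖h‖ := sub_nonneg.2 (Real.self_le_sinh_iff.2 hb)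
  nlinarith [mul_nonneg (sub_nonneg.2 hsc) hb', mul_nonneg hs hb',
    mul_nonneg (mul_nonneg hs hb') (sub_nonneg.2 h1)]

end InnerProduct

/-! ### Smooth nonnegative functions on the line. -/

section Smooth

/-- A nonnegative differentiable function on the real line with a `β`-Lipschitz derivative. -/
structure NonnegSmooth (β : ℝ) (g : ℝ → ℝ) : Prop where
  nonneg : ∀ u, 0 ≤ g u
  differentiable : Differentiable ℝ g
  deriv_lip : ∀ u v, |deriv g u - deriv g v| ≤ β * |u - v|

variable {β : ℝ} {g : ℝ → ℝ}

lemma NonnegSmooth.abs_sub_sub_le (hg : NonnegSmooth β g) (u v : ℝ) :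
    |g v - g u - deriv g u * (v - u)| ≤ β / 2 * (v - u) ^ 2 := by
  -- The sign `s = ±1` treats both sides of the absolute value at once.
  have key : ∀ s : ℝ, |s| ≤ 1 → s * (g v - g u - deriv g u * (v - u)) ≤ β / 2 * (v - u) ^ 2 := by
    intro s hs
    let φ : ℝ → ℝ := fun t => β / 2 * (v - u) ^ 2 * t ^ 2
      - s * (g (u + t * (v - u)) - deriv g u * (v - u) * t)
    have hφ : ∀ t, HasDerivAt φ (β * (v - u) ^ 2 * t
        - s * (deriv g (u + t * (v - u)) - deriv g u) * (v - u)) t := by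
      intro t
      have h1 : HasDerivAt (fun t : ℝ => u + t * (v - u)) (v - u) t := by
        simpa using ((hasDerivAt_id t).mul_const (v - u)).const_add u
      have h2 := (hg.differentiable (u + t * (v - u))).hasDerivAt.comp t h1
      have h3 := (h2.sub ((hasDerivAt_id t).const_mul (deriv g u * (v - u)))).const_mul s
      have h4 := (((hasDerivAt_id t).pow 2).const_mul (β / 2 * (v - u) ^ 2)).sub h3
      refine h4.congr_deriv ?_
      simp
      ring
    have hmono : MonotoneOn φ (Set.Icc 0 1) := by
      refine monotoneOn_of_deriv_nonneg (convex_Icc 0 1)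
        (fun t _ => (hφ t).continuousAt.continuousWithinAt)
        (fun t _ => (hφ t).differentiableAt.differentiableWithinAt) fun t ht => ?_
      rw [interior_Icc] at ht
      rw [(hφ t).deriv]
      have h1 := hg.deriv_lip (u + t * (v - u)) u
      rw [add_sub_cancel_left, abs_mul, abs_of_pos ht.1] at h1
      have h2 : s * (deriv g (u + t * (v - u)) - deriv g u) * (v - u)
          ≤ 1 * (β * (t * |v - u|)) * |v - u| := by
        refine (le_abs_self _).trans ?_
        rw [abs_mul, abs_mul]
        gcongr
      have h3 : 1 * (β * (t * |v - u|)) * |v - u| = β * (v - u) ^ 2 * t := by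
        rw [← sq_abs (v - u)]; ring
      linarith
    have := hmono (Set.left_mem_Icc.2 zero_le_one) (Set.right_mem_Icc.2 zero_le_one) zero_le_one
    simp only [φ] at this
    ring_nf at this ⊢
    linarith
  rw [abs_le]
  constructor
  · linarith [key (-1) (by simp)]
  · linarith [key 1 (by simp)]

/-- A gradient step of length `1/β` lowers `g` by at least `g'(u)²/(2β)`, and the result is still
nonnegative. -/
lemma NonnegSmooth.deriv_sq_le (hβ : 0 ≤ β) (hg : NonnegSmooth β g) (u : ℝ) :
    deriv g u ^ 2 ≤ 2 * β * g u := by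
  set p := deriv g u with hp
  have h : ∀ t : ℝ, 0 ≤ g u - t * p ^ 2 + β / 2 * t ^ 2 * p ^ 2 := by
    intro t
    have h1 := (abs_le.1 (hg.abs_sub_sub_le u (u - t * p))).2
    have h2 := hg.nonneg (u - t * p)
    rw [← hp] at h1
    ring_nf at h1 h2 ⊢
    linarith
  -- For `β = 0` a nonzero slope would let a long enough step drive `g` below zero.
  rcases hβ.eq_or_lt with h0 | hpos
  · subst h0
    by_contra hcon
    have hp2 : 0 < p ^ 2 := lt_of_not_ge (by simpa only [mul_zero, zero_mul] using hcon)
    have := h ((g u + 1) / p ^ 2)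
    rw [div_mul_cancel₀ _ hp2.ne'] at this
    linarith
  · have := h (1 / β)
    have h2 : g u - 1 / β * p ^ 2 + β / 2 * (1 / β) ^ 2 * p ^ 2 = (2 * β * g u - p ^ 2) / (2 * β) := by
      field_simp; ring
    rw [h2] at this
    have := (div_nonneg_iff.1 this)
    rcases this with h | h
    · linarith [h.1]
    · linarith [h.2]

end Smooth

/-! ### Symmetrization and contraction, one coordinate at a time. -/

section SupLike

variable {ι : Type*} [Fintype ι]

/-- Convex, `1`-Lipschitz functionals that satisfy the two-point contraction inequality behind the
Ledoux–Talagrand comparison theorem. The maximum is one, and they are closed under averages. -/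
structure IsSupLike (V : (ι → ℝ) → ℝ) : Prop where
  sub_le : ∀ A B, V A - V B ≤ ‖A - B‖
  convex : ConvexOn ℝ Set.univ V
  contraction : ∀ A a b : ι → ℝ, (∀ i j, |b i - b j| ≤ |a i - a j|) →
    V (A + b) + V (A - b) ≤ V (A + a) + V (A - a)

/-- The largest coordinate of a vector. -/
noncomputable def maxCoord [Nonempty ι] (A : ι → ℝ) : ℝ :=
  Finset.univ.sup' Finset.univ_nonempty A

lemma le_maxCoord [Nonempty ι] (A : ι → ℝ) (i : ι) : A i ≤ maxCoord A :=
  Finset.le_sup' A (Finset.mem_univ i)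

lemma exists_eq_maxCoord [Nonempty ι] (A : ι → ℝ) : ∃ i, maxCoord A = A i := by
  obtain ⟨i, -, hi⟩ := Finset.exists_mem_eq_sup' Finset.univ_nonempty A
  exact ⟨i, hi⟩

lemma isSupLike_maxCoord [Nonempty ι] : IsSupLike (maxCoord : (ι → ℝ) → ℝ) where
  sub_le A B := by
    obtain ⟨i, hi⟩ := exists_eq_maxCoord A
    have h1 := le_maxCoord B i
    have h2 := (le_abs_self _).trans (norm_le_pi_norm (A - B) i)
    rw [Pi.sub_apply] at h2
    linarith
  convex := by
    refine ⟨convex_univ, fun A _ B _ a b ha hb _ => ?_⟩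
    obtain ⟨i, hi⟩ := exists_eq_maxCoord (a • A + b • B)
    rw [hi]
    simp only [Pi.add_apply, Pi.smul_apply, smul_eq_mul]
    exact add_le_add (mul_le_mul_of_nonneg_left (le_maxCoord A i) ha)
      (mul_le_mul_of_nonneg_left (le_maxCoord B i) hb)
  contraction A a b h := by
    obtain ⟨i, hi⟩ := exists_eq_maxCoord (A + b)
    obtain ⟨j, hj⟩ := exists_eq_maxCoord (A - b)
    have h1 := (le_abs_self _).trans (h i j)
    have hip := le_maxCoord (A + a) i
    have hjp := le_maxCoord (A + a) j
    have him := le_maxCoord (A - a) i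
    have hjm := le_maxCoord (A - a) j
    simp only [Pi.add_apply, Pi.sub_apply] at *
    -- The sign of `a i - a j` decides which of the indices `i`, `j` to use in `A + a` and which in
    -- `A - a`.
    rcases abs_cases (a i - a j) with h2 | h2 <;> linarith [h2.1]

lemma IsSupLike.abs_sub_le {V : (ι → ℝ) → ℝ} (hV : IsSupLike V) (A B : ι → ℝ) :
    |V A - V B| ≤ ‖A - B‖ :=
  abs_le.2 ⟨by linarith [hV.sub_le B A, norm_sub_rev A B], hV.sub_le A B⟩

lemma IsSupLike.continuous {V : (ι → ℝ) → ℝ} (hV : IsSupLike V) : Continuous V :=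
  (LipschitzWith.of_dist_le_mul (K := 1) fun A B => by
    simpa [Real.dist_eq, dist_eq_norm] using hV.abs_sub_le A B).continuous

lemma IsSupLike.half_add {V V' : (ι → ℝ) → ℝ} (hV : IsSupLike V) (hV' : IsSupLike V') :
    IsSupLike fun A => (V A + V' A) / 2 where
  sub_le A B := by linarith [hV.sub_le A B, hV'.sub_le A B]
  convex := by
    have := (hV.convex.add hV'.convex).smul (c := 1 / 2) (by norm_num)
    refine this.congr fun A _ => ?_
    simp only [Pi.add_apply, smul_eq_mul]
    ring
  contraction A a b h := by
    linarith [hV.contraction A a b h, hV'.contraction A a b h]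

variable {Z : Type*} [MeasurableSpace Z] {μ : Measure Z}

/-- The average of `V` over the random shift `f`. -/
noncomputable def shiftAvg (μ : Measure Z) (f : Z → ι → ℝ) (V : (ι → ℝ) → ℝ) (A : ι → ℝ) : ℝ :=
  ∫ z, V (A + f z) ∂μ

/-- The average of `V` over the random shift `f` with a random sign. -/
noncomputable def symAvg (μ : Measure Z) (f : Z → ι → ℝ) (V : (ι → ℝ) → ℝ) (A : ι → ℝ) : ℝ :=
  (shiftAvg μ f V A + shiftAvg μ (-f) V A) / 2

/-- An almost everywhere measurable and essentially bounded random vector. -/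
structure BddRV (μ : Measure Z) (f : Z → ι → ℝ) (B : ℝ) : Prop where
  aesm : AEStronglyMeasurable f μ
  bound : ∀ᵐ z ∂μ, ‖f z‖ ≤ B

lemma BddRV.neg {f : Z → ι → ℝ} {B : ℝ} (hf : BddRV μ f B) : BddRV μ (-f) B :=
  ⟨hf.aesm.neg, hf.bound.mono fun z hz => by simpa using hz⟩

lemma BddRV.mean_sub {h : Z → ι → ℝ} {B : ℝ} (hh : BddRV μ h B) :
    BddRV μ (fun z => (∫ z', h z' ∂μ) - h z) (‖∫ z', h z' ∂μ‖ + B) :=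
  ⟨aestronglyMeasurable_const.sub hh.aesm, hh.bound.mono fun z hz =>
    (norm_sub_le _ _).trans (by linarith)⟩

variable [IsProbabilityMeasure μ]

lemma BddRV.integrable {f : Z → ι → ℝ} {B : ℝ} (hf : BddRV μ f B) : Integrable f μ :=
  Integrable.of_bound hf.aesm B hf.bound

lemma BddRV.integrable_comp {f : Z → ι → ℝ} {B : ℝ} (hf : BddRV μ f B) {V : (ι → ℝ) → ℝ}
    (hV : IsSupLike V) (A : ι → ℝ) : Integrable (fun z => V (A + f z)) μ := by
  refine Integrable.of_bound
    (hV.continuous.comp_aestronglyMeasurable (aestronglyMeasurable_const.add hf.aesm))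
    (|V A| + B) (hf.bound.mono fun z hz => ?_)
  have h1 := hV.abs_sub_le (A + f z) A
  rw [add_sub_cancel_left] at h1
  have h2 := abs_sub_abs_le_abs_sub (V (A + f z)) (V A)
  rw [Real.norm_eq_abs]
  linarith

/-- This closure property is what allows induction: averaging out one example turns the maximum into
another functional of the same kind, so every example is handled by the same single-step argument.
-/
lemma IsSupLike.shiftAvg {f : Z → ι → ℝ} {B : ℝ} (hf : BddRV μ f B) {V : (ι → ℝ) → ℝ}
    (hV : IsSupLike V) : IsSupLike (shiftAvg μ f V) where
  sub_le A A' := by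
    unfold _root_.shiftAvg
    rw [← integral_sub (hf.integrable_comp hV A) (hf.integrable_comp hV A')]
    refine (integral_mono (g := fun _ => ‖A - A'‖)
      ((hf.integrable_comp hV A).sub (hf.integrable_comp hV A')) (integrable_const _)
      fun z => ?_).trans (by simp)
    simpa using hV.sub_le (A + f z) (A' + f z)
  convex := by
    refine ⟨convex_univ, fun A _ A' _ a b ha hb hab => ?_⟩
    unfold _root_.shiftAvg
    rw [← integral_smul, ← integral_smul]
    refine le_trans ?_ (integral_add ((hf.integrable_comp hV A).smul a)
      ((hf.integrable_comp hV A').smul b)).le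
    refine integral_mono (hf.integrable_comp hV _)
      (((hf.integrable_comp hV A).smul a).add ((hf.integrable_comp hV A').smul b)) fun z => ?_
    have h := hV.convex.2 (Set.mem_univ (A + f z)) (Set.mem_univ (A' + f z)) ha hb hab
    have e : a • (A + f z) + b • (A' + f z) = a • A + b • A' + f z := by
      rw [smul_add, smul_add, add_add_add_comm, ← add_smul, hab, one_smul]
    rw [e] at h
    exact h
  contraction A a b h := by
    unfold _root_.shiftAvg
    rw [← integral_add (hf.integrable_comp hV _) (hf.integrable_comp hV _),
      ← integral_add (hf.integrable_comp hV _) (hf.integrable_comp hV _)]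
    refine integral_mono ((hf.integrable_comp hV _).add (hf.integrable_comp hV _))
      ((hf.integrable_comp hV _).add (hf.integrable_comp hV _)) fun z => ?_
    have := hV.contraction (A + f z) a b h
    simpa only [add_right_comm, add_sub_right_comm] using this

lemma IsSupLike.symAvg {f : Z → ι → ℝ} {B : ℝ} (hf : BddRV μ f B) {V : (ι → ℝ) → ℝ}
    (hV : IsSupLike V) : IsSupLike (symAvg μ f V) :=
  (hV.shiftAvg hf).half_add (hV.shiftAvg hf.neg)

lemma shiftAvg_mono {f : Z → ι → ℝ} {B : ℝ} (hf : BddRV μ f B) {V V' : (ι → ℝ) → ℝ}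
    (hV : IsSupLike V) (hV' : IsSupLike V') (h : ∀ A, V A ≤ V' A) (A : ι → ℝ) :
    shiftAvg μ f V A ≤ shiftAvg μ f V' A :=
  integral_mono (hf.integrable_comp hV A) (hf.integrable_comp hV' A) fun _ => h _

/-- Symmetrization and contraction in a single coordinate. -/
lemma shiftAvg_le_symAvg {h a : Z → ι → ℝ} {B B' : ℝ} (hh : BddRV μ h B) (ha : BddRV μ a B')
    {V : (ι → ℝ) → ℝ} (hV : IsSupLike V)
    (hc : ∀ᵐ z ∂μ, ∀ i j, 2 * |h z i - h z j| ≤ |a z i - a z j|) (A : ι → ℝ) :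
    shiftAvg μ (fun z => (∫ z', h z' ∂μ) - h z) V A ≤ symAvg μ a V A := by
  have h2 : BddRV μ (fun z => (2 : ℝ) • h z) (2 * B) :=
    ⟨hh.aesm.const_smul (2 : ℝ), hh.bound.mono fun z hz => by
      rw [norm_smul]; simpa using hz⟩
  have hneg : ∀ A, Integrable (fun z => V (A - (2 : ℝ) • h z)) μ := fun A => by
    simpa [sub_eq_add_neg] using h2.neg.integrable_comp hV A
  have haneg : ∀ A, Integrable (fun z => V (A - a z)) μ := fun A => by
    simpa [sub_eq_add_neg] using ha.neg.integrable_comp hV A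
  -- No ghost sample is needed: `A + E h - h` is the midpoint of `A + 2 E h` and `A - 2 h`, and
  -- Jensen moves the expectation outside `V`. This doubling is the source of the factor `2` in
  -- `hc`.
  have hJ : V (A + (2 : ℝ) • ∫ z, h z ∂μ) ≤ ∫ z, V (A + (2 : ℝ) • h z) ∂μ := by
    have := hV.convex.map_integral_le (μ := μ) (f := fun z => A + (2 : ℝ) • h z)
      hV.continuous.continuousOn isClosed_univ (by simp)
      ((integrable_const A).add h2.integrable) (h2.integrable_comp hV A)
    rwa [integral_add (integrable_const A) h2.integrable, integral_smul, integral_const,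
      probReal_univ, one_smul] at this
  have h3 : shiftAvg μ (fun z => (∫ z', h z' ∂μ) - h z) V A
      ≤ ∫ z, (V (A + (2 : ℝ) • ∫ z', h z' ∂μ) + V (A - (2 : ℝ) • h z)) / 2 ∂μ := by
    refine integral_mono (hh.mean_sub.integrable_comp hV A)
      (((integrable_const _).add (hneg A)).div_const 2) fun z => ?_
    have := hV.convex.2 (Set.mem_univ (A + (2 : ℝ) • ∫ z', h z' ∂μ))
      (Set.mem_univ (A - (2 : ℝ) • h z)) (by norm_num : (0 : ℝ) ≤ 1 / 2)
      (by norm_num : (0 : ℝ) ≤ 1 / 2) (by norm_num)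
    have e : (1 / 2 : ℝ) • (A + (2 : ℝ) • ∫ z', h z' ∂μ) + (1 / 2 : ℝ) • (A - (2 : ℝ) • h z)
        = A + ((∫ z', h z' ∂μ) - h z) := by
      module
    rw [e, smul_eq_mul, smul_eq_mul] at this
    simp only
    linarith
  have h4 : ∫ z, V (A + (2 : ℝ) • h z) + V (A - (2 : ℝ) • h z) ∂μ
      ≤ ∫ z, V (A + a z) + V (A - a z) ∂μ := by
    refine integral_mono_ae ((h2.integrable_comp hV A).add (hneg A))
      ((ha.integrable_comp hV A).add (haneg A)) (hc.mono fun z hz => ?_)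
    refine hV.contraction A (a z) ((2 : ℝ) • h z) fun i j => ?_
    have := hz i j
    rwa [Pi.smul_apply, Pi.smul_apply, ← smul_sub, smul_eq_mul, abs_mul, abs_two]
  rw [integral_div, integral_add (integrable_const _) (hneg A), integral_const, probReal_univ,
    one_smul] at h3
  rw [integral_add (h2.integrable_comp hV A) (hneg A),
    integral_add (ha.integrable_comp hV A) (haneg A)] at h4
  have h5 : symAvg μ a V A = ((∫ z, V (A + a z) ∂μ) + ∫ z, V (A - a z) ∂μ) / 2 := by
    simp only [symAvg, shiftAvg, Pi.neg_apply, ← sub_eq_add_neg]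
  rw [h5]
  linarith

variable [Nonempty ι]

lemma isSupLike_iterate_shiftAvg {f : Z → ι → ℝ} {B : ℝ} (hf : BddRV μ f B) (n : ℕ) :
    IsSupLike ((shiftAvg μ f)^[n] maxCoord) := by
  induction n with
  | zero => exact isSupLike_maxCoord
  | succ n ih => rw [Function.iterate_succ_apply']; exact ih.shiftAvg hf

lemma isSupLike_iterate_symAvg {f : Z → ι → ℝ} {B : ℝ} (hf : BddRV μ f B) (n : ℕ) :
    IsSupLike ((symAvg μ f)^[n] maxCoord) := by
  induction n with
  | zero => exact isSupLike_maxCoord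
  | succ n ih => rw [Function.iterate_succ_apply']; exact ih.symAvg hf

lemma iterate_shiftAvg_le_iterate_symAvg {h a : Z → ι → ℝ} {B B' : ℝ} (hh : BddRV μ h B)
    (ha : BddRV μ a B') (hc : ∀ᵐ z ∂μ, ∀ i j, 2 * |h z i - h z j| ≤ |a z i - a z j|) (n : ℕ)
    (A : ι → ℝ) :
    (shiftAvg μ (fun z => (∫ z', h z' ∂μ) - h z))^[n] maxCoord A
      ≤ (symAvg μ a)^[n] maxCoord A := by
  induction n generalizing A with
  | zero => exact le_rfl
  | succ n ih =>
    rw [Function.iterate_succ_apply', Function.iterate_succ_apply']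
    exact (shiftAvg_mono hh.mean_sub (isSupLike_iterate_shiftAvg hh.mean_sub n)
      (isSupLike_iterate_symAvg ha n) ih A).trans
      (shiftAvg_le_symAvg hh ha (isSupLike_iterate_symAvg ha n) hc A)

lemma half_sqrt_add_sqrt_le {p q s : ℝ} (hp : 0 ≤ p) (hq : 0 ≤ q) (h : (p + q) / 2 ≤ s) :
    (Real.sqrt p + Real.sqrt q) / 2 ≤ Real.sqrt s := by
  refine Real.le_sqrt_of_sq_le ?_
  nlinarith [Real.sq_sqrt hp, Real.sq_sqrt hq, sq_nonneg (Real.sqrt p - Real.sqrt q)]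

/-- The Rademacher average of a class of linear functions in a Hilbert space. -/
lemma iterate_symAvg_inner_le {E : Type*} [NormedAddCommGroup E] [InnerProductSpace ℝ E]
    {u : ι → E} {γ c B : ℝ} (hγ : 0 ≤ γ) (hu : ∀ i, ‖u i‖ ≤ γ) {x : Z → E}
    (hxc : ∀ᵐ z ∂μ, ‖x z‖ ≤ c) (hb : BddRV μ (fun z i => inner ℝ (u i) (x z)) B) (n : ℕ) (y : E) :
    (symAvg μ fun z i => inner ℝ (u i) (x z))^[n] maxCoord (fun i => inner ℝ (u i) y)
      ≤ γ * Real.sqrt (‖y‖ ^ 2 + n * c ^ 2) := by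
  induction n generalizing y with
  | zero =>
    obtain ⟨i, hi⟩ := exists_eq_maxCoord fun i => inner ℝ (u i) y
    simp only [Function.iterate_zero, id, hi, Nat.cast_zero, zero_mul, add_zero,
      Real.sqrt_sq (norm_nonneg y)]
    exact (real_inner_le_norm _ _).trans (mul_le_mul_of_nonneg_right (hu i) (norm_nonneg y))
  | succ n ih =>
    rw [Function.iterate_succ_apply']
    set V := (symAvg μ fun z i => inner ℝ (u i) (x z))^[n] maxCoord with hVdef
    have hV : IsSupLike V := isSupLike_iterate_symAvg hb n
    have i1 := hb.integrable_comp hV fun i => inner ℝ (u i) y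
    have i2 := hb.neg.integrable_comp hV fun i => inner ℝ (u i) y
    unfold symAvg shiftAvg
    rw [← integral_add i1 i2, ← integral_div]
    refine (integral_mono_ae (g := fun _ => γ * Real.sqrt (‖y‖ ^ 2 + (n + 1 : ℕ) * c ^ 2))
      ((i1.add i2).div_const 2) (integrable_const _) (hxc.mono fun z hz => ?_)).trans (by simp)
    have e1 : (fun i => inner ℝ (u i) y) + (fun i => inner ℝ (u i) (x z))
        = fun i => inner ℝ (u i) (y + x z) := by
      ext i; simp [inner_add_right]
    have e2 : (fun i => inner ℝ (u i) y) + (-fun z i => inner ℝ (u i) (x z)) z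
        = fun i => inner ℝ (u i) (y - x z) := by
      ext i; simp [inner_sub_right, ← sub_eq_add_neg]
    simp only [Pi.add_apply]
    rw [e1, e2]
    -- By the parallelogram law the mean of `‖y ± x z‖²` is `‖y‖² + ‖x z‖²`; concavity of the square
    -- root then closes the induction.
    have hs := half_sqrt_add_sqrt_le (p := ‖y + x z‖ ^ 2 + n * c ^ 2)
      (q := ‖y - x z‖ ^ 2 + n * c ^ 2) (s := ‖y‖ ^ 2 + (n + 1 : ℕ) * c ^ 2)
      (by positivity) (by positivity) (by
        have := parallelogram_law_with_norm ℝ y (x z)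
        have hz2 : ‖x z‖ ^ 2 ≤ c ^ 2 := by gcongr
        push_cast
        nlinarith)
    have h1 := ih (y + x z)
    have h2 := ih (y - x z)
    nlinarith [mul_le_mul_of_nonneg_left hs hγ]

end SupLike

/-! ### Exponential moments of maxima, by recursion on the sample. -/

section Concentration

open ProbabilityTheory

variable {Z : Type*} [MeasurableSpace Z] {μ : Measure Z} [IsProbabilityMeasure μ]

-- The inequality holds without measurability of `f`, and only upper bounds are needed later.
omit [IsProbabilityMeasure μ] in
lemma lintegral_pi_fin_succ_le [SigmaFinite μ] {n : ℕ} (f : (Fin (n + 1) → Z) → ℝ≥0∞) :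
    ∫⁻ S, f S ∂(Measure.pi fun _ : Fin (n + 1) => μ)
      ≤ ∫⁻ z, ∫⁻ S, f (Fin.cons z S) ∂(Measure.pi fun _ : Fin n => μ) ∂μ := by
  have h := (measurePreserving_piFinSuccAbove (fun _ : Fin (n + 1) => μ) 0).symm
  rw [← h.map_eq, lintegral_map_equiv]
  refine (lintegral_prod_le _).trans (le_of_eq ?_)
  refine lintegral_congr fun z => lintegral_congr fun S => congrArg f ?_
  exact Fin.insertNth_zero' z S

lemma ae_pi_forall {n : ℕ} {p : Z → Prop} (h : ∀ᵐ z ∂μ, p z) :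
    ∀ᵐ S ∂(Measure.pi fun _ : Fin n => μ), ∀ i, p (S i) := by
  rw [ae_all_iff]
  intro i
  exact (Measure.tendsto_eval_ae_ae (μ := fun _ : Fin n => μ) (i := i)).eventually h

/-- Hoeffding's lemma for the exponential moment. -/
lemma lintegral_exp_le_of_abs_sub_le {G : Z → ℝ} (hG : AEMeasurable G μ) {a B : ℝ} (hB : 0 ≤ B)
    (hab : ∀ᵐ z ∂μ, |G z - a| ≤ B) (t : ℝ) :
    ∫⁻ z, ENNReal.ofReal (Real.exp (t * G z)) ∂μ
      ≤ ENNReal.ofReal (Real.exp (t * (∫ z, G z ∂μ) + t ^ 2 * B ^ 2 / 2)) := by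
  have hI : ∀ᵐ z ∂μ, G z ∈ Set.Icc (a - B) (a + B) := hab.mono fun z hz => by
    have := abs_le.1 hz
    exact ⟨by linarith, by linarith⟩
  have hsub := hasSubgaussianMGF_of_mem_Icc hG hI
  have hc : (((‖a + B - (a - B)‖₊ / 2) ^ 2 : NNReal) : ℝ) = B ^ 2 := by
    have h : a + B - (a - B) = 2 * B := by ring
    rw [h]
    push_cast
    rw [Real.norm_eq_abs, abs_of_nonneg (by positivity)]
    ring
  have h1 := hsub.mgf_le t
  rw [hc] at h1
  have hint := hsub.integrable_exp_mul t
  have e : ∀ z, ENNReal.ofReal (Real.exp (t * G z)) = ENNReal.ofReal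
      (Real.exp (t * ∫ z, G z ∂μ)) * ENNReal.ofReal (Real.exp (t * (G z - ∫ z, G z ∂μ))) := by
    intro z
    rw [← ENNReal.ofReal_mul (Real.exp_pos _).le, ← Real.exp_add]
    congr 2
    ring
  simp only [e]
  rw [lintegral_const_mul' _ _ ENNReal.ofReal_ne_top,
    ← ofReal_integral_eq_lintegral_ofReal hint (Filter.Eventually.of_forall fun z =>
      (Real.exp_pos _).le), ← ENNReal.ofReal_mul (Real.exp_pos _).le]
  refine ENNReal.ofReal_le_ofReal ?_
  rw [Real.exp_add]
  refine mul_le_mul_of_nonneg_left (h1.trans (le_of_eq ?_)) (Real.exp_pos _).le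
  ring_nf

variable {ι : Type*} [Fintype ι] [Nonempty ι]

/-- McDiarmid's inequality for the exponential moment of a maximum of sums. -/
lemma lintegral_exp_maxCoord_le {f : Z → ι → ℝ} {B' : ℝ} (hf : BddRV μ f B') {m : ι → ℝ} {B : ℝ}
    (hB : 0 ≤ B) (hfm : ∀ᵐ z ∂μ, ‖f z - m‖ ≤ B) (t : ℝ) (n : ℕ) (A : ι → ℝ) :
    ∫⁻ S, ENNReal.ofReal (Real.exp (t * maxCoord (A + ∑ k, f (S k))))
        ∂(Measure.pi fun _ : Fin n => μ)
      ≤ ENNReal.ofReal (Real.exp (t * (shiftAvg μ f)^[n] maxCoord A + n * (t ^ 2 * B ^ 2 / 2))) := by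
  induction n generalizing A with
  | zero => simp
  | succ n ih =>
    refine (lintegral_pi_fin_succ_le _).trans ?_
    have hV := isSupLike_iterate_shiftAvg hf n
    calc ∫⁻ z, ∫⁻ S, ENNReal.ofReal (Real.exp (t * maxCoord
            (A + ∑ k, f (Fin.cons (α := fun _ => Z) z S k)))) ∂(Measure.pi fun _ : Fin n => μ) ∂μ
        ≤ ∫⁻ z, ENNReal.ofReal (Real.exp (t * (shiftAvg μ f)^[n] maxCoord (A + f z)))
            * ENNReal.ofReal (Real.exp (n * (t ^ 2 * B ^ 2 / 2))) ∂μ := by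
          refine lintegral_mono fun z => ?_
          have := ih (A + f z)
          rw [Real.exp_add, ENNReal.ofReal_mul (Real.exp_pos _).le] at this
          simpa [Fin.sum_univ_succ, add_assoc] using this
      _ ≤ ENNReal.ofReal (Real.exp (t * (∫ z, (shiftAvg μ f)^[n] maxCoord (A + f z) ∂μ)
            + t ^ 2 * B ^ 2 / 2)) * ENNReal.ofReal (Real.exp (n * (t ^ 2 * B ^ 2 / 2))) := by
          rw [lintegral_mul_const' _ _ ENNReal.ofReal_ne_top]
          gcongr
          -- The averaged functional is 1-Lipschitz, so a single example moves it by at most `B`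
          -- from its value at `A + m`. This is the bounded-difference property.
          refine lintegral_exp_le_of_abs_sub_le (a := (shiftAvg μ f)^[n] maxCoord (A + m))
            (hf.integrable_comp hV A).aestronglyMeasurable.aemeasurable hB
            (hfm.mono fun z hz => ?_) t
          have := hV.abs_sub_le (A + f z) (A + m)
          rw [add_sub_add_left_eq_sub] at this
          exact this.trans hz
      _ = _ := by
          rw [← ENNReal.ofReal_mul (Real.exp_pos _).le, ← Real.exp_add,
            Function.iterate_succ_apply']
          simp only [shiftAvg]
          congr 2
          push_cast
          ring

omit [IsProbabilityMeasure μ] in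
lemma measure_lt_le_of_lintegral_exp {Y : Z → ℝ} (hY : AEMeasurable Y μ) {a b t : ℝ} (ht : 0 ≤ t)
    (h : ∫⁻ z, ENNReal.ofReal (Real.exp (t * Y z)) ∂μ ≤ ENNReal.ofReal (Real.exp b)) :
    μ {z | a < Y z} ≤ ENNReal.ofReal (Real.exp (b - t * a)) := by
  have hsub : {z | a < Y z} ⊆ {z | ENNReal.ofReal (Real.exp (t * a))
      ≤ ENNReal.ofReal (Real.exp (t * Y z))} := fun z hz => by
    have hz' : a < Y z := hz
    change ENNReal.ofReal _ ≤ ENNReal.ofReal _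
    gcongr
  have hm := mul_meas_ge_le_lintegral₀ (μ := μ)
    (f := fun z => ENNReal.ofReal (Real.exp (t * Y z)))
    ((Real.measurable_exp.comp_aemeasurable (hY.const_mul t)).ennreal_ofReal)
    (ENNReal.ofReal (Real.exp (t * a)))
  refine (measure_mono hsub).trans ?_
  rw [Real.exp_sub, ENNReal.ofReal_div_of_pos (Real.exp_pos _)]
  rw [ENNReal.le_div_iff_mul_le (Or.inl (by simp [Real.exp_pos])) (Or.inl (by simp)), mul_comm]
  exact hm.trans h

/-- Uniform deviation of a finite class of functions that are Lipschitz functions of linear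
functions in a Hilbert space. -/
lemma measure_exists_lt_sum_le {E : Type*} [NormedAddCommGroup E] [InnerProductSpace ℝ E]
    {h : Z → ι → ℝ} {B : ℝ} (hB : 0 ≤ B) (hh : BddRV μ h B) {u : ι → E} {γ c B' : ℝ}
    (hγ : 0 ≤ γ) (hu : ∀ i, ‖u i‖ ≤ γ) {x : Z → E} (hxc : ∀ᵐ z ∂μ, ‖x z‖ ≤ c)
    (hb : BddRV μ (fun z i => inner ℝ (u i) (x z)) B')
    (hc : ∀ᵐ z ∂μ, ∀ i j, 2 * |h z i - h z j| ≤ |inner ℝ (u i) (x z) - inner ℝ (u j) (x z)|)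
    (n : ℕ) {τ : ℝ} (hτ : 0 ≤ τ) :
    (Measure.pi fun _ : Fin n => μ) {S | ∃ i, γ * Real.sqrt (n * c ^ 2) + B * Real.sqrt (2 * n * τ)
        < ∑ k, ((∫ z, h z ∂μ) i - h (S k) i)}
      ≤ ENNReal.ofReal (Real.exp (-τ)) := by
  set f : Z → ι → ℝ := fun z => (∫ z', h z' ∂μ) - h z with hf
  have hJ : (shiftAvg μ f)^[n] maxCoord 0 ≤ γ * Real.sqrt (n * c ^ 2) := by
    refine (iterate_shiftAvg_le_iterate_symAvg hh hb hc n 0).trans ?_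
    have := iterate_symAvg_inner_le hγ hu hxc hb n 0
    simpa [Pi.zero_def] using this
  -- When `n B = 0` the sums vanish almost surely; otherwise the choice of `t` below makes sense.
  rcases (mul_nonneg hB (Nat.cast_nonneg n : (0 : ℝ) ≤ n)).eq_or_lt with h0 | hpos
  · have hz : ∀ᵐ S ∂(Measure.pi fun _ : Fin n => μ), ∀ i,
        ∑ k, ((∫ z, h z ∂μ) i - h (S k) i) = 0 := by
      rcases mul_eq_zero.1 h0.symm with h0 | h0
      · have h1 : ∀ᵐ z ∂μ, h z = 0 := hh.bound.mono fun z hz =>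
          norm_le_zero_iff.1 (hz.trans h0.le)
        have h2 : ∫ z, h z ∂μ = 0 := integral_eq_zero_of_ae h1
        filter_upwards [ae_pi_forall (n := n) h1] with S hS i
        simp [h2, hS]
      · have hn : n = 0 := by exact_mod_cast h0
        subst hn
        simp
    refine le_of_eq_of_le (measure_eq_zero_iff_ae_notMem.2 (hz.mono fun S hS hmem => ?_))
      zero_le
    obtain ⟨i, hi⟩ := hmem
    rw [hS i] at hi
    have : 0 ≤ γ * Real.sqrt (n * c ^ 2) + B * Real.sqrt (2 * n * τ) := by positivity
    linarith
  · have hBpos : 0 < B := by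
      rcases hB.eq_or_lt with h | h
      · rw [← h] at hpos; simp at hpos
      · exact h
    have hnpos : (0 : ℝ) < n := by
      rcases (Nat.cast_nonneg n : (0 : ℝ) ≤ n).eq_or_lt with h | h
      · rw [← h] at hpos; simp at hpos
      · exact h
    -- This `t` minimizes `n t² B² / 2 - t B √(2 n τ)`, with minimum `-τ`.
    set t := Real.sqrt (2 * n * τ) / (n * B) with ht
    have hfm : ∀ᵐ z ∂μ, ‖f z - ∫ z', h z' ∂μ‖ ≤ B := hh.bound.mono fun z hz => by
      simpa [hf] using hz
    have hmgf := lintegral_exp_maxCoord_le hh.mean_sub hB hfm t n 0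
    have hsum : AEStronglyMeasurable (fun S : Fin n → Z => (0 : ι → ℝ) + ∑ k, f (S k))
        (Measure.pi fun _ : Fin n => μ) := by
      refine aestronglyMeasurable_const.add ?_
      have := Finset.univ.aestronglyMeasurable_fun_sum (fun k _ =>
        hh.mean_sub.aesm.comp_quasiMeasurePreserving
          (Measure.quasiMeasurePreserving_eval (fun _ : Fin n => μ) k))
      exact this
    have hY : AEMeasurable (fun S : Fin n → Z => maxCoord ((0 : ι → ℝ) + ∑ k, f (S k)))
        (Measure.pi fun _ : Fin n => μ) :=
      (isSupLike_maxCoord.continuous.comp_aestronglyMeasurable hsum).aemeasurable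
    have := measure_lt_le_of_lintegral_exp hY
      (a := γ * Real.sqrt (n * c ^ 2) + B * Real.sqrt (2 * n * τ)) (by positivity) hmgf
    refine (measure_mono fun S hS => ?_).trans (this.trans (ENNReal.ofReal_le_ofReal
      (Real.exp_le_exp.2 ?_)))
    · obtain ⟨i, hi⟩ := hS
      refine hi.trans_le ((le_of_eq ?_).trans (le_maxCoord _ i))
      simp [hf]
    · have ht0 : 0 ≤ t := by positivity
      have h1 := mul_le_mul_of_nonneg_left hJ ht0
      have hs : Real.sqrt (2 * n * τ) * Real.sqrt (2 * n * τ) = 2 * n * τ :=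
        Real.mul_self_sqrt (by positivity)
      have h2 : t * (B * Real.sqrt (2 * n * τ)) = 2 * τ := by
        rw [ht]; field_simp; linarith
      have h3 : n * (t ^ 2 * B ^ 2 / 2) = τ := by
        rw [ht, div_pow, Real.sq_sqrt (by positivity)]; field_simp
      linarith

end Concentration

/-! ### A Bernstein inequality in Hilbert space. -/

section Bernstein

variable {Z : Type*} [MeasurableSpace Z] {μ : Measure Z} [IsProbabilityMeasure μ]
  {E : Type*} [NormedAddCommGroup E] [InnerProductSpace ℝ E] [CompleteSpace E]

lemma lintegral_cosh_norm_add_le {U : Z → E} (hU : AEStronglyMeasurable U μ) {b : ℝ}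
    (hb : ∀ᵐ z ∂μ, ‖U z‖ ≤ b) (h0 : ∫ z, U z ∂μ = 0) (y : E) :
    ∫⁻ z, ENNReal.ofReal (Real.cosh ‖y + U z‖) ∂μ
      ≤ ENNReal.ofReal (Real.cosh ‖y‖ * (1 + ∫ z, (Real.exp ‖U z‖ - 1 - ‖U z‖) ∂μ)) := by
  have hUi : Integrable U μ := Integrable.of_bound hU b hb
  have hexp : Integrable (fun z => Real.exp ‖U z‖) μ :=
    Integrable.of_bound (Real.continuous_exp.comp_aestronglyMeasurable hU.norm) (Real.exp b)
      (hb.mono fun z hz => by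
        rw [Real.norm_eq_abs, abs_of_pos (Real.exp_pos _)]
        exact Real.exp_le_exp.2 hz)
  have hE : Integrable (fun z => Real.exp ‖U z‖ - 1 - ‖U z‖) μ :=
    (hexp.sub (integrable_const 1)).sub hUi.norm
  have hI : Integrable (fun z => Real.sinh ‖y‖ / ‖y‖ * inner ℝ y (U z)) μ :=
    (hUi.const_inner y).const_mul _
  refine (lintegral_mono fun z => ENNReal.ofReal_le_ofReal (cosh_norm_add_le y (U z))).trans ?_
  have hIc : Integrable (fun z => Real.cosh ‖y‖ + Real.sinh ‖y‖ / ‖y‖ * inner ℝ y (U z)) μ :=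
    (integrable_const _).add hI
  have hint : Integrable (fun z => Real.cosh ‖y‖ + Real.sinh ‖y‖ / ‖y‖ * inner ℝ y (U z)
      + Real.cosh ‖y‖ * (Real.exp ‖U z‖ - 1 - ‖U z‖)) μ :=
    hIc.add (hE.const_mul _)
  rw [← ofReal_integral_eq_lintegral_ofReal hint (Filter.Eventually.of_forall fun z =>
    (Real.cosh_pos _).le.trans (cosh_norm_add_le y (U z)))]
  refine ENNReal.ofReal_le_ofReal (le_of_eq ?_)
  rw [integral_add hIc (hE.const_mul _),
    integral_add (integrable_const _) hI, integral_const_mul, integral_const_mul,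
    integral_inner hUi, h0]
  simp
  ring

/-- `cosh ‖·‖` replaces the exponential of a scalar sum: each centered summand multiplies its
expectation by at most `1 + q ≤ exp q`, in any dimension. -/
lemma lintegral_cosh_norm_add_sum_le {U : Z → E} (hU : AEStronglyMeasurable U μ) {b q : ℝ}
    (hb : ∀ᵐ z ∂μ, ‖U z‖ ≤ b) (h0 : ∫ z, U z ∂μ = 0)
    (hq : ∫ z, (Real.exp ‖U z‖ - 1 - ‖U z‖) ∂μ ≤ q) (n : ℕ) (y : E) :
    ∫⁻ S, ENNReal.ofReal (Real.cosh ‖y + ∑ k, U (S k)‖) ∂(Measure.pi fun _ : Fin n => μ)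
      ≤ ENNReal.ofReal (Real.cosh ‖y‖ * Real.exp (n * q)) := by
  induction n generalizing y with
  | zero => simp
  | succ n ih =>
    refine (lintegral_pi_fin_succ_le _).trans ?_
    calc ∫⁻ z, ∫⁻ S, ENNReal.ofReal (Real.cosh
            ‖y + ∑ k, U (Fin.cons (α := fun _ => Z) z S k)‖) ∂(Measure.pi fun _ : Fin n => μ) ∂μ
        ≤ ∫⁻ z, ENNReal.ofReal (Real.cosh ‖y + U z‖) * ENNReal.ofReal (Real.exp (n * q)) ∂μ := by
          refine lintegral_mono fun z => ?_
          have := ih (y + U z)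
          rw [ENNReal.ofReal_mul (Real.cosh_pos _).le] at this
          simpa [Fin.sum_univ_succ, add_assoc] using this
      _ ≤ ENNReal.ofReal (Real.cosh ‖y‖ * Real.exp q) * ENNReal.ofReal (Real.exp (n * q)) := by
          rw [lintegral_mul_const' _ _ ENNReal.ofReal_ne_top]
          gcongr
          refine (lintegral_cosh_norm_add_le hU hb h0 y).trans (ENNReal.ofReal_le_ofReal ?_)
          refine mul_le_mul_of_nonneg_left ?_ (Real.cosh_pos _).le
          linarith [Real.add_one_le_exp q]
      _ = _ := by
          rw [← ENNReal.ofReal_mul (by positivity), mul_assoc, ← Real.exp_add]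
          congr 3
          push_cast
          ring

/-- Bernstein's inequality for sums of independent bounded centered vectors of a Hilbert space. -/
lemma measure_lt_norm_sum_le {X : Z → E} (hX : AEStronglyMeasurable X μ) {b v : ℝ} (hb0 : 0 ≤ b)
    (hb : ∀ᵐ z ∂μ, ‖X z‖ ≤ b) (h0 : ∫ z, X z ∂μ = 0) (hv : ∫ z, ‖X z‖ ^ 2 ∂μ ≤ v) (n : ℕ)
    {τ : ℝ} (hτ : 0 ≤ τ) :
    (Measure.pi fun _ : Fin n => μ)
      {S | b * τ + Real.sqrt (4 * n * v * τ) < ‖∑ k, X (S k)‖}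
      ≤ ENNReal.ofReal (2 * Real.exp (-τ)) := by
  have hv0 : 0 ≤ v := le_trans (integral_nonneg fun z => by positivity) hv
  have hX2 : Integrable (fun z => ‖X z‖ ^ 2) μ :=
    Integrable.of_bound (hX.norm.pow 2) (b ^ 2) (hb.mono fun z hz => by
      rw [Real.norm_eq_abs, abs_of_nonneg (by positivity)]
      gcongr)
  rcases (mul_nonneg hv0 (Nat.cast_nonneg n : (0 : ℝ) ≤ n)).eq_or_lt with h | hpos
  · have hz : ∀ᵐ S ∂(Measure.pi fun _ : Fin n => μ), ∑ k, X (S k) = 0 := by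
      rcases mul_eq_zero.1 h.symm with h | h
      · have h1 : ∀ᵐ z ∂μ, X z = 0 := by
          have h2 : ∫ z, ‖X z‖ ^ 2 ∂μ = 0 :=
            le_antisymm (hv.trans h.le) (integral_nonneg fun z => by positivity)
          rw [integral_eq_zero_iff_of_nonneg (fun z => by positivity) hX2] at h2
          exact h2.mono fun z hz => by simpa using hz
        filter_upwards [ae_pi_forall (n := n) h1] with S hS
        simp [hS]
      · have hn : n = 0 := by exact_mod_cast h
        subst hn
        simp
    refine le_of_eq_of_le (measure_eq_zero_iff_ae_notMem.2 (hz.mono fun S hS hmem => ?_))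
      zero_le
    have hmem' : b * τ + Real.sqrt (4 * n * v * τ) < ‖∑ k, X (S k)‖ := hmem
    rw [hS, norm_zero] at hmem'
    have : 0 ≤ b * τ + Real.sqrt (4 * n * v * τ) := by positivity
    linarith
  · set s := Real.sqrt (τ / (v * n)) with hs
    have hs0 : 0 ≤ s := Real.sqrt_nonneg _
    have hs2 : v * n * s ^ 2 = τ := by
      rw [hs, Real.sq_sqrt (by positivity), mul_div_cancel₀ _ hpos.ne']
    have hsq : Real.sqrt (4 * n * v * τ) = 2 * (v * n) * s := by
      rw [← Real.sqrt_sq (by positivity : 0 ≤ 2 * (v * n) * s)]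
      congr 1
      rw [← hs2]
      ring
    have hcs : 0 < 1 + b * s := by positivity
    -- With this choice `1 - t b = 1 / (1 + b s)`: the exponent becomes `τ / (1 + b s)` and `t`
    -- times the threshold `(b s τ + 2 τ) / (1 + b s)`, and they differ by exactly `τ`.
    set t := s / (1 + b * s) with ht
    have ht0 : 0 ≤ t := by positivity
    have htb : 1 - t * b = 1 / (1 + b * s) := by rw [ht]; field_simp; ring
    have htb1 : t * b < 1 := by
      have : 0 < 1 - t * b := by rw [htb]; positivity
      linarith
    have hUb : ∀ᵐ z ∂μ, ‖t • X z‖ ≤ t * b := hb.mono fun z hz => by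
      rw [norm_smul, Real.norm_eq_abs, abs_of_nonneg ht0]
      gcongr
    have hq : ∫ z, (Real.exp ‖t • X z‖ - 1 - ‖t • X z‖) ∂μ ≤ t ^ 2 / (1 - t * b) * v := by
      have h1 : 0 < 1 - t * b := by linarith
      refine le_trans (integral_mono_of_nonneg (Filter.Eventually.of_forall fun z => ?_)
        (hX2.const_mul (t ^ 2 / (1 - t * b))) (hUb.mono fun z hz => ?_)) ?_
      · have := Real.add_one_le_exp ‖t • X z‖
        simp only [Pi.zero_apply]
        linarith
      · refine (Real.exp_sub_one_sub_le_sq_div (norm_nonneg _) (hz.trans_lt htb1)).trans ?_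
        have h2 : ‖t • X z‖ ^ 2 = t ^ 2 * ‖X z‖ ^ 2 := by
          rw [norm_smul, mul_pow, Real.norm_eq_abs, sq_abs]
        change _ ≤ t ^ 2 / (1 - t * b) * ‖X z‖ ^ 2
        rw [div_mul_eq_mul_div, ← h2]
        gcongr
      · rw [integral_const_mul]
        gcongr
    have hmgf := lintegral_cosh_norm_add_sum_le (hX.const_smul t) hUb
      ((integral_smul t X).trans (by rw [h0, smul_zero])) hq n 0
    have hY : AEMeasurable (fun S : Fin n → Z => ‖∑ k, X (S k)‖)
        (Measure.pi fun _ : Fin n => μ) :=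
      (Finset.univ.aestronglyMeasurable_fun_sum (fun k _ =>
        hX.comp_quasiMeasurePreserving
          (Measure.quasiMeasurePreserving_eval (fun _ : Fin n => μ) k))).norm.aemeasurable
    have hexp : ∫⁻ S, ENNReal.ofReal (Real.exp (t * ‖∑ k, X (S k)‖))
        ∂(Measure.pi fun _ : Fin n => μ)
          ≤ ENNReal.ofReal (Real.exp (Real.log 2 + n * (t ^ 2 / (1 - t * b) * v))) := by
      calc _ ≤ ∫⁻ S, ENNReal.ofReal 2 * ENNReal.ofReal (Real.cosh ‖0 + ∑ k, t • X (S k)‖)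
            ∂(Measure.pi fun _ : Fin n => μ) := by
            refine lintegral_mono fun S => ?_
            rw [← ENNReal.ofReal_mul zero_le_two]
            refine ENNReal.ofReal_le_ofReal ?_
            rw [zero_add, ← Finset.smul_sum, norm_smul, Real.norm_eq_abs, abs_of_nonneg ht0,
              Real.cosh_eq]
            linarith [Real.exp_pos (-(t * ‖∑ k, X (S k)‖))]
        _ ≤ _ := by
            rw [lintegral_const_mul' _ _ ENNReal.ofReal_ne_top]
            refine (mul_le_mul_right hmgf _).trans ?_
            rw [← ENNReal.ofReal_mul zero_le_two, Real.exp_add, Real.exp_log two_pos]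
            simp
    refine (measure_lt_le_of_lintegral_exp hY ht0 hexp).trans (ENNReal.ofReal_le_ofReal ?_)
    rw [← Real.exp_log (two_pos : (0 : ℝ) < 2), ← Real.exp_add, Real.exp_log two_pos]
    refine Real.exp_le_exp.2 ?_
    have h1 : n * (t ^ 2 / (1 - t * b) * v) = τ / (1 + b * s) := by
      rw [htb, ht, ← hs2]; field_simp
    have h2 : t * (b * τ + Real.sqrt (4 * n * v * τ)) = (b * s * τ + 2 * τ) / (1 + b * s) := by
      rw [hsq, ht, div_mul_eq_mul_div]
      congr 1
      linear_combination 2 * hs2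
    have h3 : (b * s * τ + 2 * τ) / (1 + b * s) - τ / (1 + b * s) = τ := by
      field_simp; ring
    linarith

end Bernstein

/-! ### First-order optimality and the loss of a linear predictor. -/

section Deterministic

variable {E : Type*} [NormedAddCommGroup E] [InnerProductSpace ℝ E]

/-- First-order optimality for a strongly convex function `F` at a minimizer of a function `Fh`,
when `F - Fh` is smooth with gradient `p` there. -/
lemma StrongConvexOn.sub_add_le_inner {W : Set E} {lam : ℝ} {F Fh : E → ℝ}
    (hF : StrongConvexOn W lam F) (hlam : 0 ≤ lam) {a b : E} (ha : a ∈ W) (hb : b ∈ W)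
    (hmin : IsMinOn Fh W b) {p : E} {L : ℝ} (hL : 0 ≤ L)
    (hsmooth : ∀ v ∈ W, |(F v - Fh v) - (F b - Fh b) - inner ℝ p (v - b)| ≤ L * ‖v - b‖ ^ 2) :
    F b - F a + lam / 2 * ‖b - a‖ ^ 2 ≤ inner ℝ p (b - a) := by
  -- Compare `b` with the point a fraction `t` of the way to `a`, divide by `t`, and let `t` tend to
  -- zero. No subgradient is involved.
  have key : ∀ t : ℝ, 0 < t → t < 1 → F b - F a + lam / 2 * ‖b - a‖ ^ 2 - inner ℝ p (b - a)
      ≤ t * ((L + lam / 2) * ‖b - a‖ ^ 2) := by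
    intro t ht0 ht1
    have h1t : 0 ≤ 1 - t := by linarith
    have hconv := hF.2 hb ha h1t ht0.le (by ring)
    have hmem := hF.1 hb ha h1t ht0.le (by ring)
    set v := (1 - t) • b + t • a with hv
    have hvb : v - b = (-t) • (b - a) := by rw [hv]; module
    have h2 : Fh b ≤ Fh v := hmin hmem
    have h3 := (abs_le.1 (hsmooth v hmem)).1
    rw [hvb, inner_smul_right, norm_smul, mul_pow, Real.norm_eq_abs, sq_abs] at h3
    simp only [smul_eq_mul] at hconv
    have h4 : t * (F b - F a + lam / 2 * ‖b - a‖ ^ 2 - inner ℝ p (b - a))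
        ≤ t * (t * ((L + lam / 2) * ‖b - a‖ ^ 2)) := by
      linarith
    exact le_of_mul_le_mul_left h4 ht0
  have hY : 0 ≤ (L + lam / 2) * ‖b - a‖ ^ 2 := by positivity
  generalize (L + lam / 2) * ‖b - a‖ ^ 2 = Y at key hY
  suffices h : F b - F a + lam / 2 * ‖b - a‖ ^ 2 - inner ℝ p (b - a) ≤ 0 by linarith
  refine le_of_forall_pos_le_add fun ε hε => ?_
  have ht : 0 < min (1 / 2) (ε / (Y + 1)) := by positivity
  refine (key _ ht ((min_le_left _ _).trans_lt (by norm_num))).trans ?_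
  calc min (1 / 2) (ε / (Y + 1)) * Y ≤ ε / (Y + 1) * (Y + 1) := by
        gcongr
        · exact min_le_right _ _
        · linarith
    _ = 0 + ε := by field_simp; ring

/-- On `W`, the function `f` is a nonnegative `β`-smooth function of `⟨w, x⟩`, with gradient `G`. -/
def IsLinearLossAt (W : Set E) (β D : ℝ) (x : E) (f : E → ℝ) (G : E → E) : Prop :=
  ‖x‖ ≤ D ∧ ∃ g, NonnegSmooth β g ∧
    ∀ w ∈ W, f w = g (inner ℝ w x) ∧ G w = deriv g (inner ℝ w x) • x

namespace IsLinearLossAt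

variable {W : Set E} {β D : ℝ} {x : E} {f : E → ℝ} {G : E → E}

lemma nonneg (h : IsLinearLossAt W β D x f G) {w : E} (hw : w ∈ W) : 0 ≤ f w := by
  obtain ⟨-, g, hg, hfg⟩ := h
  rw [(hfg w hw).1]
  exact hg.nonneg _

lemma norm_sq_le (h : IsLinearLossAt W β D x f G) (hβ : 0 ≤ β) {w : E} (hw : w ∈ W) :
    ‖G w‖ ^ 2 ≤ 2 * (β * D ^ 2) * f w := by
  obtain ⟨hx, g, hg, hfg⟩ := h
  rw [(hfg w hw).1, (hfg w hw).2, norm_smul, mul_pow, Real.norm_eq_abs, sq_abs]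
  calc deriv g (inner ℝ w x) ^ 2 * ‖x‖ ^ 2 ≤ (2 * β * g (inner ℝ w x)) * D ^ 2 := by
        have := hg.nonneg (inner ℝ w x)
        exact mul_le_mul (hg.deriv_sq_le hβ _) (by gcongr) (by positivity) (by positivity)
    _ = _ := by ring

lemma abs_sub_sub_le (h : IsLinearLossAt W β D x f G) (hβ : 0 ≤ β) {v w : E} (hv : v ∈ W)
    (hw : w ∈ W) : |f v - f w - inner ℝ (G w) (v - w)| ≤ β * D ^ 2 / 2 * ‖v - w‖ ^ 2 := by
  obtain ⟨hx, g, hg, hfg⟩ := h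
  have h1 := hg.abs_sub_sub_le (inner ℝ w x) (inner ℝ v x)
  rw [(hfg w hw).1, (hfg w hw).2, (hfg v hv).1, real_inner_smul_left,
    real_inner_comm (v - w) x]
  rw [← inner_sub_left] at h1
  refine h1.trans ?_
  have h2 : (inner ℝ (v - w) x) ^ 2 ≤ (‖v - w‖ * D) ^ 2 := by
    rw [← sq_abs]
    gcongr
    exact (abs_real_inner_le_norm _ _).trans (by gcongr)
  calc β / 2 * (inner ℝ (v - w) x) ^ 2 ≤ β / 2 * (‖v - w‖ * D) ^ 2 := by gcongr
    _ = _ := by ring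

lemma norm_sub_le (h : IsLinearLossAt W β D x f G) (hβ : 0 ≤ β) {v w : E} (hv : v ∈ W)
    (hw : w ∈ W) : ‖G v - G w‖ ≤ β * D ^ 2 * ‖v - w‖ := by
  obtain ⟨hx, g, hg, hfg⟩ := h
  have h1 := hg.deriv_lip (inner ℝ v x) (inner ℝ w x)
  rw [(hfg w hw).2, (hfg v hv).2, ← sub_smul, norm_smul, Real.norm_eq_abs]
  rw [← inner_sub_left] at h1
  have h2 : |inner ℝ (v - w) x| ≤ ‖v - w‖ * D :=
    (abs_real_inner_le_norm _ _).trans (by gcongr)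
  have hD : 0 ≤ D := (norm_nonneg x).trans hx
  calc _ ≤ (β * (‖v - w‖ * D)) * D := by
        refine mul_le_mul (h1.trans (by gcongr)) hx (norm_nonneg _) (by positivity)
    _ = _ := by ring

lemma abs_inner_sub_le (h : IsLinearLossAt W β D x f G) (hβ : 0 ≤ β) {w a : E} (hw : w ∈ W)
    (ha : a ∈ W) : |inner ℝ (G w - G a) (w - a)| ≤ β * D ^ 2 * ‖w - a‖ ^ 2 :=
  (abs_real_inner_le_norm _ _).trans <| by
    rw [pow_two ‖w - a‖, ← mul_assoc]
    gcongr
    exact h.norm_sub_le hβ hw ha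

/-- The excess depends on `w` only through `⟨w, x⟩`. It is a product of two factors bounded by `β γ
D` and `γ D`, with Lipschitz constants `β` and `1`, so the product rule gives `2 β D γ`. This makes
scalar contraction applicable to gradients. -/
lemma abs_inner_sub_inner_le (h : IsLinearLossAt W β D x f G) (hβ : 0 ≤ β) {v w a : E}
    (hv : v ∈ W) (hw : w ∈ W) (ha : a ∈ W) {γ : ℝ} (hvγ : ‖v - a‖ ≤ γ) (hwγ : ‖w - a‖ ≤ γ) :
    |inner ℝ (G v - G a) (v - a) - inner ℝ (G w - G a) (w - a)|
      ≤ 2 * β * D * γ * |inner ℝ (v - w) x| := by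
  obtain ⟨hx, g, hg, hfg⟩ := h
  have hD : 0 ≤ D := (norm_nonneg x).trans hx
  rw [(hfg w hw).2, (hfg v hv).2, (hfg a ha).2, ← sub_smul, ← sub_smul, real_inner_smul_left,
    real_inner_smul_left, real_inner_comm (v - a) x, real_inner_comm (w - a) x]
  have h1 := hg.deriv_lip (inner ℝ v x) (inner ℝ w x)
  have h2 := hg.deriv_lip (inner ℝ w x) (inner ℝ a x)
  rw [← inner_sub_left] at h1 h2
  have hb : ∀ y : E, ‖y‖ ≤ γ → |inner ℝ y x| ≤ γ * D := fun y hy =>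
    (abs_real_inner_le_norm _ _).trans (by gcongr; exact (norm_nonneg _).trans hy)
  have e : (deriv g (inner ℝ v x) - deriv g (inner ℝ a x)) * inner ℝ (v - a) x
      - (deriv g (inner ℝ w x) - deriv g (inner ℝ a x)) * inner ℝ (w - a) x
      = (deriv g (inner ℝ v x) - deriv g (inner ℝ w x)) * inner ℝ (v - a) x
      + (deriv g (inner ℝ w x) - deriv g (inner ℝ a x)) * inner ℝ (v - w) x := by
    simp only [inner_sub_left]
    ring
  rw [e]
  refine (abs_add_le _ _).trans ?_
  rw [abs_mul, abs_mul]
  calc _ ≤ β * |inner ℝ (v - w) x| * (γ * D) + β * (γ * D) * |inner ℝ (v - w) x| := by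
        refine add_le_add (mul_le_mul h1 (hb _ hvγ) (abs_nonneg _) (by positivity)) ?_
        refine mul_le_mul_of_nonneg_right (h2.trans ?_) (abs_nonneg _)
        exact mul_le_mul_of_nonneg_left (hb _ hwγ) hβ
    _ = _ := by ring

end IsLinearLossAt

variable {Z : Type*} [MeasurableSpace Z] {μ : Measure Z} [CompleteSpace E]

/-- `E` need not be separable, but `x` lies almost surely in a separable closed subspace. Only the
projection of `w` onto it matters, and the projected set has a countable dense subset. -/
lemma exists_countable_inner_dense {x : Z → E} (hx : AEStronglyMeasurable x μ) (T : Set E) :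
    ∃ c ⊆ T, c.Countable ∧ ∃ V : Set E, (∀ᵐ z ∂μ, x z ∈ V) ∧
      ∀ w ∈ T, ∀ ε > 0, ∃ w₀ ∈ c, ∀ y ∈ V, |inner ℝ (w - w₀) y| ≤ ε * ‖y‖ := by
  obtain ⟨t, ht, hxt⟩ := hx.isSeparable_ae_range
  set V := (Submodule.span ℝ t).topologicalClosure with hV
  have hVsep : TopologicalSpace.IsSeparable (V : Set E) := by
    rw [hV, Submodule.topologicalClosure_coe]
    exact (TopologicalSpace.IsSeparable.span ht).closure
  have : CompleteSpace V := (Submodule.isClosed_topologicalClosure _).completeSpace_coe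
  have himg : TopologicalSpace.IsSeparable (V.starProjection '' T) := by
    refine hVsep.mono ?_
    rintro _ ⟨w, -, rfl⟩
    exact V.starProjection_apply_mem w
  obtain ⟨d, hdT, hdc, hd⟩ := himg.exists_countable_dense_subset
  have hdT' : ∀ y ∈ d, ∃ w ∈ T, V.starProjection w = y := fun y hy => hdT hy
  choose! q hqT hq using hdT'
  refine ⟨q '' d, ?_, hdc.image q, V, hxt.mono fun z hz =>
    Submodule.le_topologicalClosure _ (Submodule.subset_span hz), fun w hw ε hε => ?_⟩
  · rintro _ ⟨y, hy, rfl⟩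
    exact hqT y hy
  · obtain ⟨y, hy, hdist⟩ := Metric.mem_closure_iff.1 (hd (Set.mem_image_of_mem _ hw)) ε hε
    refine ⟨q y, Set.mem_image_of_mem _ hy, fun u hu => ?_⟩
    have h1 : inner ℝ (w - q y) u = inner ℝ (V.starProjection w - y) u := by
      rw [show V.starProjection w - y = V.starProjection (w - q y) by rw [map_sub, hq y hy],
        Submodule.inner_starProjection_left_eq_right, Submodule.starProjection_eq_self_iff.2 hu]
    rw [h1]
    refine (abs_real_inner_le_norm _ _).trans ?_
    rw [← dist_eq_norm]
    gcongr

end Deterministic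

/-! ### Deviation bounds for the gradients of the loss. -/

section Model

lemma norm_integral_le_of_ae_le {Z F : Type*} [MeasurableSpace Z] {μ : Measure Z}
    [IsProbabilityMeasure μ] [NormedAddCommGroup F] [NormedSpace ℝ F] {g : Z → F} {C : ℝ}
    (h : ∀ᵐ z ∂μ, ‖g z‖ ≤ C) : ‖∫ z, g z ∂μ‖ ≤ C := by
  simpa using norm_integral_le_of_norm_le_const h

variable {E : Type*} [NormedAddCommGroup E] [InnerProductSpace ℝ E]
  {Z : Type*} [MeasurableSpace Z]

/-- The loss `f w z` is, for almost every example `z`, a nonnegative `β`-smooth function of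
`⟨w, x z⟩`, with gradient `G w z`, and its expectation is finite on `W`. -/
structure IsSmoothLinearModel (μ : Measure Z) (W : Set E) (β D : ℝ) (x : Z → E) (f : E → Z → ℝ)
    (G : E → Z → E) : Prop where
  aesm_x : AEStronglyMeasurable x μ
  aesm_grad : ∀ w ∈ W, AEStronglyMeasurable (G w) μ
  integrable : ∀ w ∈ W, Integrable (f w) μ
  spec : ∀ᵐ z ∂μ, IsLinearLossAt W β D (x z) (fun w => f w z) fun w => G w z

namespace IsSmoothLinearModel

variable {μ : Measure Z} [IsProbabilityMeasure μ] {W : Set E} {β D : ℝ} {x : Z → E}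
  {f : E → Z → ℝ} {G : E → Z → E}

lemma zero_le_radius (h : IsSmoothLinearModel μ W β D x f G) : 0 ≤ D := by
  obtain ⟨z, hz⟩ := h.spec.exists
  exact (norm_nonneg _).trans hz.1

lemma integrable_grad (h : IsSmoothLinearModel μ W β D x f G) (hβ : 0 ≤ β) {w : E} (hw : w ∈ W) :
    Integrable (G w) μ := by
  refine ((integrable_const (1 : ℝ)).add ((h.integrable w hw).const_mul (2 * (β * D ^ 2)))).mono'
    (h.aesm_grad w hw) (h.spec.mono fun z hz => ?_)
  have := hz.norm_sq_le hβ hw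
  simp only [Pi.add_apply]
  nlinarith [sq_nonneg (‖G w z‖ - 1), norm_nonneg (G w z)]

variable [CompleteSpace E]

lemma abs_integral_sub_sub_le (h : IsSmoothLinearModel μ W β D x f G) (hβ : 0 ≤ β) {v w : E}
    (hv : v ∈ W) (hw : w ∈ W) :
    |(∫ z, f v z ∂μ) - (∫ z, f w z ∂μ) - inner ℝ (∫ z, G w z ∂μ) (v - w)|
      ≤ β * D ^ 2 / 2 * ‖v - w‖ ^ 2 := by
  have hG := h.integrable_grad hβ hw
  have hGi : Integrable (fun z => inner ℝ (G w z) (v - w)) μ := hG.inner_const _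
  have hfi : Integrable (fun z => f v z - f w z) μ := (h.integrable v hv).sub (h.integrable w hw)
  have e : (∫ z, f v z ∂μ) - (∫ z, f w z ∂μ) - inner ℝ (∫ z, G w z ∂μ) (v - w)
      = ∫ z, (f v z - f w z - inner ℝ (G w z) (v - w)) ∂μ := by
    rw [integral_sub hfi hGi, integral_sub (h.integrable v hv) (h.integrable w hw),
      real_inner_comm, ← integral_inner hG]
    simp only [real_inner_comm]
  rw [e, ← Real.norm_eq_abs]
  refine norm_integral_le_of_ae_le (h.spec.mono fun z hz => ?_)
  exact hz.abs_sub_sub_le hβ hv hw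

omit [CompleteSpace E] [MeasurableSpace Z] in
lemma abs_average_sub_sub_le {n : ℕ} (hn : 0 < n) {S : Fin n → Z}
    (hS : ∀ i, IsLinearLossAt W β D (x (S i)) (fun w => f w (S i)) fun w => G w (S i))
    (hβ : 0 ≤ β) {v w : E} (hv : v ∈ W) (hw : w ∈ W) :
    |(1 / (n : ℝ)) * (∑ i, f v (S i)) - (1 / (n : ℝ)) * (∑ i, f w (S i))
      - inner ℝ ((1 / (n : ℝ)) • ∑ i, G w (S i)) (v - w)| ≤ β * D ^ 2 / 2 * ‖v - w‖ ^ 2 := by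
  have hn' : (0 : ℝ) < n := by exact_mod_cast hn
  rw [real_inner_smul_left, sum_inner, ← mul_sub, ← mul_sub, ← Finset.sum_sub_distrib,
    ← Finset.sum_sub_distrib, abs_mul, abs_of_pos (by positivity), one_div,
    inv_mul_le_iff₀ hn']
  refine (Finset.abs_sum_le_sum_abs _ _).trans ?_
  refine (Finset.sum_le_sum fun i _ => (hS i).abs_sub_sub_le hβ hv hw).trans (by simp)

omit [IsProbabilityMeasure μ] [CompleteSpace E] in
lemma aesm_excess (h : IsSmoothLinearModel μ W β D x f G) {w a : E} (hw : w ∈ W) (ha : a ∈ W) :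
    AEStronglyMeasurable (fun z => inner ℝ (G w z - G a z) (w - a)) μ :=
  ((h.aesm_grad w hw).sub (h.aesm_grad a ha)).inner aestronglyMeasurable_const

omit [CompleteSpace E] in
lemma integrable_excess (h : IsSmoothLinearModel μ W β D x f G) (hβ : 0 ≤ β) {w a : E}
    (hw : w ∈ W) (ha : a ∈ W) : Integrable (fun z => inner ℝ (G w z - G a z) (w - a)) μ :=
  ((h.integrable_grad hβ hw).sub (h.integrable_grad hβ ha)).inner_const _

-- The vectors `u i = 4 β D γ (e i - a)` combine the Lipschitz constant `2 β D γ` with the factor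
-- `2` from symmetrization.
omit [CompleteSpace E] in
lemma measure_exists_excess_fintype_le (h : IsSmoothLinearModel μ W β D x f G) (hβ : 0 ≤ β)
    {a : E} (ha : a ∈ W) {γ : ℝ} (hγ : 0 ≤ γ) {ι : Type*} [Fintype ι] [Nonempty ι] {e : ι → E}
    (heW : ∀ i, e i ∈ W) (heγ : ∀ i, ‖e i - a‖ ≤ γ) (n : ℕ) {τ : ℝ} (hτ : 0 ≤ τ) :
    (Measure.pi fun _ : Fin n => μ) {S | ∃ i,
      4 * (β * D ^ 2 * γ ^ 2) * Real.sqrt n + β * D ^ 2 * γ ^ 2 * Real.sqrt (2 * n * τ)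
        < ∑ k, ((∫ z, inner ℝ (G (e i) z - G a z) (e i - a) ∂μ)
          - inner ℝ (G (e i) (S k) - G a (S k)) (e i - a))} ≤ ENNReal.ofReal (Real.exp (-τ)) := by
  have hD := h.zero_le_radius
  have hc0 : 0 ≤ 4 * β * D * γ := by positivity
  have hu : ∀ i, ‖(4 * β * D * γ) • (e i - a)‖ ≤ 4 * β * D * γ * γ := fun i => by
    rw [norm_smul, Real.norm_eq_abs, abs_of_nonneg hc0]
    exact mul_le_mul_of_nonneg_left (heγ i) hc0
  have hh : BddRV μ (fun z i => inner ℝ (G (e i) z - G a z) (e i - a)) (β * D ^ 2 * γ ^ 2) := by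
    refine ⟨(aemeasurable_pi_iff.2 fun i =>
      (h.aesm_excess (heW i) ha).aemeasurable).aestronglyMeasurable, h.spec.mono fun z hz => ?_⟩
    rw [pi_norm_le_iff_of_nonneg (by positivity)]
    intro i
    refine (hz.abs_inner_sub_le hβ (heW i) ha).trans ?_
    have := heγ i
    gcongr
  have hb : BddRV μ (fun z i => inner ℝ ((4 * β * D * γ) • (e i - a)) (x z))
      (4 * β * D * γ * γ * D) := by
    refine ⟨(aemeasurable_pi_iff.2 fun i =>
      (aestronglyMeasurable_const.inner h.aesm_x).aemeasurable).aestronglyMeasurable,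
      h.spec.mono fun z hz => ?_⟩
    rw [pi_norm_le_iff_of_nonneg (by positivity)]
    intro i
    exact (abs_real_inner_le_norm _ _).trans
      (mul_le_mul (hu i) hz.1 (norm_nonneg _) (by positivity))
  have key := measure_exists_lt_sum_le (by positivity) hh (by positivity) hu
    (h.spec.mono fun z hz => hz.1) hb (h.spec.mono fun z hz i j => ?_) n hτ
  · refine (measure_mono fun S hS => ?_).trans key
    obtain ⟨i, hi⟩ := hS
    refine ⟨i, ?_⟩
    rw [eval_integral (fun i => h.integrable_excess hβ (heW i) ha) i]
    refine lt_of_eq_of_lt ?_ hi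
    rw [Real.sqrt_mul (Nat.cast_nonneg n), Real.sqrt_sq hD]
    ring
  · rw [← inner_sub_left, ← smul_sub, sub_sub_sub_cancel_right, real_inner_smul_left, abs_mul,
      abs_of_nonneg hc0]
    have := hz.abs_inner_sub_inner_le hβ (heW i) (heW j) ha (heγ i) (heγ j)
    linarith

/-- Uniform deviation of the gradients over a ball around `a`. -/
lemma measure_exists_excess_le (h : IsSmoothLinearModel μ W β D x f G) (hβ : 0 ≤ β)
    {a : E} (ha : a ∈ W) {γ : ℝ} (hγ : 0 ≤ γ) (n : ℕ) {τ : ℝ} (hτ : 0 ≤ τ) :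
    (Measure.pi fun _ : Fin n => μ) {S | ∃ w ∈ W, ‖w - a‖ ≤ γ ∧
      4 * (β * D ^ 2 * γ ^ 2) * Real.sqrt n + β * D ^ 2 * γ ^ 2 * Real.sqrt (2 * n * τ)
        < ∑ k, ((∫ z, inner ℝ (G w z - G a z) (w - a) ∂μ)
          - inner ℝ (G w (S k) - G a (S k)) (w - a))} ≤ ENNReal.ofReal (Real.exp (-τ)) := by
  have hD := h.zero_le_radius
  set B := 4 * (β * D ^ 2 * γ ^ 2) * Real.sqrt n + β * D ^ 2 * γ ^ 2 * Real.sqrt (2 * n * τ) with hB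
  set Y : (Fin n → Z) → E → ℝ := fun S w => ∑ k, ((∫ z, inner ℝ (G w z - G a z) (w - a) ∂μ)
          - inner ℝ (G w (S k) - G a (S k)) (w - a)) with hY
  obtain ⟨c, hcT, hcc, V, hxV, hV⟩ :=
    exists_countable_inner_dense h.aesm_x {w | w ∈ W ∧ ‖w - a‖ ≤ γ}
  have haT : a ∈ {w | w ∈ W ∧ ‖w - a‖ ≤ γ} := ⟨ha, by simpa using hγ⟩
  have hcne : c.Nonempty := by
    obtain ⟨w₀, hw₀, -⟩ := hV a haT 1 one_pos
    exact ⟨w₀, hw₀⟩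
  obtain ⟨e, he⟩ := hcc.exists_eq_range hcne
  have heT : ∀ i, e i ∈ W ∧ ‖e i - a‖ ≤ γ := fun i => hcT (he ▸ Set.mem_range_self i)
  -- Continuity of the measure along these increasing events passes from finite classes to the
  -- countable one without loss.
  have hmono : Monotone fun N : ℕ => {S : Fin n → Z | ∃ i : Fin (N + 1), B < Y S (e i)} := by
    rintro N N' hN S ⟨i, hi⟩
    exact ⟨Fin.castLE (by omega) i, hi⟩
  have hcount : (Measure.pi fun _ : Fin n => μ)
      (⋃ N : ℕ, {S : Fin n → Z | ∃ i : Fin (N + 1), B < Y S (e i)})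
      ≤ ENNReal.ofReal (Real.exp (-τ)) := by
    rw [hmono.measure_iUnion]
    exact iSup_le fun N => h.measure_exists_excess_fintype_le hβ ha hγ (e := fun i : Fin (N + 1) => e i)
      (fun i => (heT i).1) (fun i => (heT i).2) n hτ
  refine (measure_mono_ae ?_).trans hcount
  filter_upwards [ae_pi_forall (n := n) (h.spec.and hxV)] with S hS hmem
  obtain ⟨w, hw, hwγ, hlt⟩ := hmem
  have hlt' : B < Y S w := hlt
  -- The violation at `w` is strict, so it survives at a close enough point of the countable class.
  obtain ⟨ε, hε, hεlt⟩ : ∃ ε > 0, n * (2 * (2 * β * D * γ * (ε * D))) < Y S w - B := by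
    have hK : 0 ≤ n * (2 * (2 * β * D * γ * D)) := by positivity
    refine ⟨(Y S w - B) / (n * (2 * (2 * β * D * γ * D)) + 1),
      div_pos (sub_pos.2 hlt') (by positivity), ?_⟩
    have e1 : ∀ ε, n * (2 * (2 * β * D * γ * (ε * D))) = n * (2 * (2 * β * D * γ * D)) * ε :=
      fun ε => by ring
    rw [e1, mul_div_assoc', div_lt_iff₀ (by positivity)]
    nlinarith [sub_pos.2 hlt']
  obtain ⟨w₀, hw₀, happ⟩ := hV w ⟨hw, hwγ⟩ ε hε
  have hw₀T := hcT hw₀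
  have hdiff : ∀ z, IsLinearLossAt W β D (x z) (fun w => f w z) (fun w => G w z) → x z ∈ V →
      |inner ℝ (G w z - G a z) (w - a) - inner ℝ (G w₀ z - G a z) (w₀ - a)|
        ≤ 2 * β * D * γ * (ε * D) := fun z hz hzV => by
    refine (hz.abs_inner_sub_inner_le hβ hw hw₀T.1 ha hwγ hw₀T.2).trans ?_
    have := (happ (x z) hzV).trans (mul_le_mul_of_nonneg_left hz.1 hε.le)
    gcongr
  have hmean : |(∫ z, inner ℝ (G w z - G a z) (w - a) ∂μ)
      - ∫ z, inner ℝ (G w₀ z - G a z) (w₀ - a) ∂μ| ≤ 2 * β * D * γ * (ε * D) := by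
    rw [← integral_sub (h.integrable_excess hβ hw ha) (h.integrable_excess hβ hw₀T.1 ha),
      ← Real.norm_eq_abs]
    refine norm_integral_le_of_ae_le ?_
    filter_upwards [h.spec, hxV] with z hz hzV
    exact hdiff z hz hzV
  have hYdiff : Y S w - Y S w₀ ≤ n * (2 * (2 * β * D * γ * (ε * D))) := by
    simp only [hY]
    rw [← Finset.sum_sub_distrib]
    refine (Finset.sum_le_sum fun k _ => ?_).trans (by simp : ∑ _k : Fin n,
      (2 * (2 * β * D * γ * (ε * D))) ≤ _)
    have h1 := (abs_le.1 (hdiff (S k) (hS k).1 (hS k).2)).1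
    have h2 := (abs_le.1 hmean).2
    linarith
  rw [he] at hw₀
  obtain ⟨i, rfl⟩ := hw₀
  refine Set.mem_iUnion.2 ⟨i, ⟨i, Nat.lt_succ_self i⟩, ?_⟩
  change B < Y S (e i)
  linarith

/-- Concentration of the empirical gradient at `a`. -/
lemma measure_lt_norm_sum_grad_le (h : IsSmoothLinearModel μ W β D x f G) (hβ : 0 ≤ β)
    {a : E} (ha : a ∈ W) {M : ℝ} (hM0 : 0 ≤ M) (hM : ∀ᵐ z ∂μ, ‖G a z‖ ≤ M) (n : ℕ) {τ : ℝ}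
    (hτ : 0 ≤ τ) :
    (Measure.pi fun _ : Fin n => μ) {S | 2 * M * τ
        + Real.sqrt (8 * n * (β * D ^ 2) * (∫ z, f a z ∂μ) * τ)
          < ‖∑ k, ((∫ z, G a z ∂μ) - G a (S k))‖}
      ≤ ENNReal.ofReal (2 * Real.exp (-τ)) := by
  have hG := h.integrable_grad hβ ha
  have hmean : ‖∫ z, G a z ∂μ‖ ≤ M := norm_integral_le_of_ae_le hM
  have h2 : Integrable (fun z => ‖G a z‖ ^ 2) μ :=
    Integrable.of_bound (hG.1.norm.pow 2) (M ^ 2) (hM.mono fun z hz => by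
      rw [Real.norm_eq_abs, abs_of_nonneg (by positivity)]
      gcongr)
  -- Centering does not increase the second moment, and `‖G‖² ≤ 2 β D² f` pointwise.
  have hvar : ∫ z, ‖(∫ z, G a z ∂μ) - G a z‖ ^ 2 ∂μ ≤ 2 * (β * D ^ 2) * ∫ z, f a z ∂μ := by
    have hGi : Integrable (fun z => 2 * inner ℝ (∫ z, G a z ∂μ) (G a z)) μ :=
      (hG.const_inner _).const_mul 2
    have hci : Integrable (fun z => ‖∫ z, G a z ∂μ‖ ^ 2
        - 2 * inner ℝ (∫ z, G a z ∂μ) (G a z)) μ := (integrable_const _).sub hGi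
    have h3 : ∫ z, ‖G a z‖ ^ 2 ∂μ ≤ 2 * (β * D ^ 2) * ∫ z, f a z ∂μ := by
      rw [← integral_const_mul]
      exact integral_mono_ae h2 ((h.integrable a ha).const_mul _)
        (h.spec.mono fun z hz => hz.norm_sq_le hβ ha)
    simp only [norm_sub_sq_real]
    rw [integral_add hci h2, integral_sub (integrable_const _) hGi, integral_const_mul,
      integral_inner hG, real_inner_self_eq_norm_sq, integral_const, probReal_univ, one_smul]
    nlinarith [sq_nonneg ‖∫ z, G a z ∂μ‖]
  have key := measure_lt_norm_sum_le (X := fun z => (∫ z, G a z ∂μ) - G a z) (b := 2 * M)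
    (aestronglyMeasurable_const.sub hG.1) (by positivity)
    (hM.mono fun z hz => (norm_sub_le _ _).trans (by linarith))
    (by rw [integral_sub (integrable_const _) hG]; simp) hvar n hτ
  refine (measure_mono fun S hS => ?_).trans key
  have hS' : 2 * M * τ + Real.sqrt (8 * n * (β * D ^ 2) * (∫ z, f a z ∂μ) * τ)
      < ‖∑ k, ((∫ z, G a z ∂μ) - G a (S k))‖ := hS
  refine lt_of_eq_of_lt ?_ hS'
  congr 2
  ring

end IsSmoothLinearModel

end Model

/-! ### Peeling over dyadic radii, and the typical sample. -/

section Peeling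

lemma exists_dyadic_radius {n : ℕ} (hn : 0 < n) {d R : ℝ} (hd : 1 / (n : ℝ) ^ 2 < d)
    (hdR : d ≤ 2 * R) :
    ∃ k ∈ Finset.Icc 1 ⌈2 * Real.logb 2 (n : ℝ) + Real.logb 2 (2 * R)⌉.toNat,
      d ≤ 2 ^ k / (n : ℝ) ^ 2 ∧ 2 ^ k / (n : ℝ) ^ 2 ≤ 2 * d := by
  have hn' : (0 : ℝ) < n := by exact_mod_cast hn
  have hn2 : (0 : ℝ) < (n : ℝ) ^ 2 := by positivity
  have h1 : 1 < (n : ℝ) ^ 2 * d := by rwa [div_lt_iff₀ hn2, mul_comm] at hd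
  have hd0 : 0 < d := lt_trans (by positivity) hd
  have hR0 : 0 < 2 * R := hd0.trans_le hdR
  have hpos : 0 < (n : ℝ) ^ 2 * d := by positivity
  set l := Real.logb 2 ((n : ℝ) ^ 2 * d) with hl
  have hl0 : 0 < l := Real.logb_pos one_lt_two h1
  have hpow : (2 : ℝ) ^ l = (n : ℝ) ^ 2 * d := Real.rpow_logb two_pos (by norm_num) hpos
  have hle : l ≤ 2 * Real.logb 2 (n : ℝ) + Real.logb 2 (2 * R) := by
    have e : 2 * Real.logb 2 (n : ℝ) + Real.logb 2 (2 * R)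
        = Real.logb 2 ((n : ℝ) ^ 2 * (2 * R)) := by
      rw [Real.logb_mul hn2.ne' hR0.ne', Real.logb_pow]
      norm_num
    rw [e, hl]
    exact Real.logb_le_logb_of_le one_lt_two hpos (by gcongr)
  refine ⟨⌈l⌉₊, Finset.mem_Icc.2 ⟨Nat.ceil_pos.2 hl0, ?_⟩, ?_, ?_⟩
  · rw [Int.ceil_toNat]
    exact Nat.ceil_mono hle
  · rw [le_div_iff₀ hn2, mul_comm, ← hpow, ← Real.rpow_natCast]
    exact Real.rpow_le_rpow_of_exponent_le one_le_two (Nat.le_ceil l)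
  · rw [div_le_iff₀ hn2]
    have h2 : (2 : ℝ) ^ (⌈l⌉₊ : ℝ) ≤ 2 ^ (l + 1) :=
      Real.rpow_le_rpow_of_exponent_le one_le_two (Nat.ceil_lt_add_one hl0.le).le
    rw [Real.rpow_natCast, Real.rpow_add two_pos, Real.rpow_one, hpow] at h2
    linarith

lemma complexityConst_nonneg (n : ℕ) (R δ : ℝ) : 0 ≤ complexityConst n R δ := by
  unfold complexityConst
  positivity

variable {E : Type*} [NormedAddCommGroup E] [InnerProductSpace ℝ E] [CompleteSpace E]
  {Z : Type*} [MeasurableSpace Z] {μ : Measure Z} [IsProbabilityMeasure μ] {W : Set E} {β D : ℝ}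
  {x : Z → E} {f : E → Z → ℝ} {G : E → Z → E}

namespace IsSmoothLinearModel

/-- Uniform deviation of the gradients outside of a small ball around `a`, by peeling. -/
lemma measure_exists_shell_excess_le (h : IsSmoothLinearModel μ W β D x f G) (hβ : 0 ≤ β)
    {a : E} (ha : a ∈ W) {n : ℕ} (hn : 0 < n) (R : ℝ) {δ : ℝ} (hδ0 : 0 < δ) (hδ1 : δ < 1) :
    (Measure.pi fun _ : Fin n => μ) {S | ∃ w ∈ W, 1 / (n : ℝ) ^ 2 < ‖w - a‖ ∧ ‖w - a‖ ≤ 2 * R ∧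
      β * D ^ 2 * ‖w - a‖ ^ 2 * Real.sqrt n * complexityConst n R δ
        < ∑ k, ((∫ z, inner ℝ (G w z - G a z) (w - a) ∂μ)
          - inner ℝ (G w (S k) - G a (S k)) (w - a))} ≤ ENNReal.ofReal δ := by
  have hn' : (0 : ℝ) < n := by exact_mod_cast hn
  set s := ⌈2 * Real.logb 2 (n : ℝ) + Real.logb 2 (2 * R)⌉ with hs
  set τ := Real.log ((s : ℝ) / δ) with hτ
  have hC : complexityConst n R δ = 4 * (8 + Real.sqrt (2 * τ)) := rfl
  have hsub : {S : Fin n → Z | ∃ w ∈ W, 1 / (n : ℝ) ^ 2 < ‖w - a‖ ∧ ‖w - a‖ ≤ 2 * R ∧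
      β * D ^ 2 * ‖w - a‖ ^ 2 * Real.sqrt n * complexityConst n R δ
        < ∑ k, ((∫ z, inner ℝ (G w z - G a z) (w - a) ∂μ)
          - inner ℝ (G w (S k) - G a (S k)) (w - a))}
      ⊆ ⋃ j ∈ Finset.Icc 1 s.toNat, {S | ∃ w ∈ W, ‖w - a‖ ≤ 2 ^ j / (n : ℝ) ^ 2 ∧
      4 * (β * D ^ 2 * (2 ^ j / (n : ℝ) ^ 2) ^ 2) * Real.sqrt n
        + β * D ^ 2 * (2 ^ j / (n : ℝ) ^ 2) ^ 2 * Real.sqrt (2 * n * τ)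
        < ∑ k, ((∫ z, inner ℝ (G w z - G a z) (w - a) ∂μ)
          - inner ℝ (G w (S k) - G a (S k)) (w - a))} := by
    rintro S ⟨w, hw, hd, hdR, hlt⟩
    obtain ⟨j, hj, hj1, hj2⟩ := exists_dyadic_radius hn hd hdR
    refine Set.mem_biUnion hj ⟨w, hw, hj1, lt_of_le_of_lt ?_ hlt⟩
    have hγ : 0 ≤ (2 : ℝ) ^ j / (n : ℝ) ^ 2 := by positivity
    generalize (2 : ℝ) ^ j / (n : ℝ) ^ 2 = γ at hj1 hj2 hγ
    have e : Real.sqrt (2 * n * τ) = Real.sqrt n * Real.sqrt (2 * τ) := by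
      rw [← Real.sqrt_mul hn'.le]
      congr 1
      ring
    have hq : 0 ≤ Real.sqrt (2 * τ) := Real.sqrt_nonneg _
    rw [e, hC]
    -- The shell radius overshoots `‖w - a‖` by at most a factor `2`; squared, this is the leading
    -- `4` of the constant.
    calc _ = β * D ^ 2 * γ ^ 2 * Real.sqrt n * (4 + Real.sqrt (2 * τ)) := by ring
      _ ≤ β * D ^ 2 * (2 * ‖w - a‖) ^ 2 * Real.sqrt n * (8 + Real.sqrt (2 * τ)) := by
          gcongr
          norm_num
      _ = _ := by ring
  refine (measure_mono hsub).trans ((measure_biUnion_finset_le _ _).trans ?_)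
  -- If the ceiling is nonpositive there are no shells, and the value of `τ` plays no role.
  rcases Nat.eq_zero_or_pos s.toNat with h0 | hpos
  · simp [h0]
  · have hs1 : 1 ≤ s := by omega
    have hs1' : (1 : ℝ) ≤ s := by exact_mod_cast hs1
    have hτ0 : 0 ≤ τ := by
      refine Real.log_nonneg ?_
      rw [le_div_iff₀ hδ0]
      linarith
    have hexp : Real.exp (-τ) = δ / s := by
      rw [Real.exp_neg, hτ, Real.exp_log (by positivity), inv_div]
    refine (Finset.sum_le_sum fun j _ => h.measure_exists_excess_le hβ ha
      (γ := 2 ^ j / (n : ℝ) ^ 2) (by positivity) n hτ0).trans ?_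
    have hcast : ((s.toNat : ℕ) : ℝ) = s := by
      exact_mod_cast Int.toNat_of_nonneg (by omega : 0 ≤ s)
    rw [Finset.sum_const, Nat.card_Icc, Nat.add_sub_cancel, nsmul_eq_mul, hexp,
      ← ENNReal.ofReal_natCast, ← ENNReal.ofReal_mul (Nat.cast_nonneg _), hcast,
      mul_div_cancel₀ _ (by positivity)]

/-- The sample fluctuates around the distribution by at most what the risk bounds allow. -/
def Typical (μ : Measure Z) (W : Set E) (β D : ℝ) (x : Z → E) (f : E → Z → ℝ) (G : E → Z → E)
    (a : E) (M R δ : ℝ) (n : ℕ) (S : Fin n → Z) : Prop :=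
  (∀ i, IsLinearLossAt W β D (x (S i)) (fun w => f w (S i)) fun w => G w (S i)) ∧
  (∀ w ∈ W, 1 / (n : ℝ) ^ 2 < ‖w - a‖ → ‖w - a‖ ≤ 2 * R →
    ∑ k, ((∫ z, inner ℝ (G w z - G a z) (w - a) ∂μ) - inner ℝ (G w (S k) - G a (S k)) (w - a))
      ≤ β * D ^ 2 * ‖w - a‖ ^ 2 * Real.sqrt n * complexityConst n R δ) ∧
  ‖∑ k, ((∫ z, G a z ∂μ) - G a (S k))‖ ≤ 2 * M * Real.log (2 / δ)
    + Real.sqrt (8 * n * (β * D ^ 2) * (∫ z, f a z ∂μ) * Real.log (2 / δ))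

lemma measure_not_typical_le (h : IsSmoothLinearModel μ W β D x f G) (hβ : 0 ≤ β) {a : E}
    (ha : a ∈ W) {M : ℝ} (hM0 : 0 ≤ M) (hM : ∀ᵐ z ∂μ, ‖G a z‖ ≤ M) {n : ℕ} (hn : 0 < n) (R : ℝ)
    {δ : ℝ} (hδ0 : 0 < δ) (hδ1 : δ < 1) :
    (Measure.pi fun _ : Fin n => μ) {S | Typical μ W β D x f G a M R δ n S}ᶜ
      ≤ ENNReal.ofReal (2 * δ) := by
  have h1 := h.measure_exists_shell_excess_le hβ ha hn R hδ0 hδ1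
  have hτ : 0 ≤ Real.log (2 / δ) := by
    refine Real.log_nonneg ?_
    rw [le_div_iff₀ hδ0]
    linarith
  have h2 := h.measure_lt_norm_sum_grad_le hβ ha hM0 hM n hτ
  have hexp : 2 * Real.exp (-Real.log (2 / δ)) = δ := by
    rw [Real.exp_neg, Real.exp_log (by positivity), inv_div]
    ring
  rw [hexp] at h2
  refine (measure_mono_ae (t := _ ∪ _) ?_).trans ((measure_union_le _ _).trans
    ((add_le_add h1 h2).trans (le_of_eq ?_)))
  · filter_upwards [ae_pi_forall (n := n) h.spec] with S hS hmem
    by_contra hcon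
    have hcon' := not_or.1 hcon
    refine hmem ⟨hS, fun w hw hd hdR => ?_, ?_⟩
    · by_contra hlt
      exact hcon'.1 ⟨w, hw, hd, hdR, not_le.1 hlt⟩
    · by_contra hlt
      exact hcon'.2 (not_le.1 hlt)
  · rw [← ENNReal.ofReal_add hδ0.le hδ0.le, two_mul]

/-- On a typical sample, the first-order inequality for minimizers of the empirical risk. -/
lemma Typical.excess_risk_le (h : IsSmoothLinearModel μ W β D x f G) (hβ : 0 ≤ β) {a : E}
    (ha : a ∈ W) {M R δ : ℝ} {n : ℕ} (hn : 0 < n) {S : Fin n → Z}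
    (hS : Typical μ W β D x f G a M R δ n S) {r : E → ℝ} {lam : ℝ} (hlam : 0 ≤ lam)
    (hF : StrongConvexOn W lam fun w => (∫ z, f w z ∂μ) + r w) {b : E} (hb : b ∈ W)
    (hmin : IsMinOn (fun w => (1 / (n : ℝ)) * (∑ i, f w (S i)) + r w) W b)
    (hd : 1 / (n : ℝ) ^ 2 < ‖b - a‖) (hdR : ‖b - a‖ ≤ 2 * R) :
    (∫ z, f b z ∂μ) + r b - ((∫ z, f a z ∂μ) + r a) + lam / 2 * ‖b - a‖ ^ 2
      ≤ β * D ^ 2 * complexityConst n R δ / Real.sqrt n * ‖b - a‖ ^ 2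
        + (2 * M * Real.log (2 / δ) / n
          + Real.sqrt (8 * (β * D ^ 2) * (∫ z, f a z ∂μ) * Real.log (2 / δ) / n)) * ‖b - a‖ := by
  obtain ⟨hspec, huni, hbern⟩ := hS
  have hn' : (0 : ℝ) < n := by exact_mod_cast hn
  have hfirst := hF.sub_add_le_inner (Fh := fun w => (1 / (n : ℝ)) * (∑ i, f w (S i)) + r w) hlam
    ha hb hmin (p := (∫ z, G b z ∂μ) - (1 / (n : ℝ)) • ∑ i, G b (S i)) (L := β * D ^ 2)
    (by positivity) fun v hv => by
      have h1 := h.abs_integral_sub_sub_le hβ hv hb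
      have h2 := abs_average_sub_sub_le hn hspec hβ hv hb
      rw [inner_sub_left]
      rw [abs_le] at h1 h2 ⊢
      constructor <;> linarith [h1.1, h1.2, h2.1, h2.2]
  refine hfirst.trans ?_
  have hGa := h.integrable_grad hβ ha
  have hGb := h.integrable_grad hβ hb
  have hmean : ∫ z, inner ℝ (G b z - G a z) (b - a) ∂μ
      = inner ℝ ((∫ z, G b z ∂μ) - ∫ z, G a z ∂μ) (b - a) := by
    have hGd : Integrable (fun z => G b z - G a z) μ := hGb.sub hGa
    rw [← integral_sub hGb hGa, real_inner_comm, ← integral_inner hGd]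
    simp only [real_inner_comm]
  -- The gradient error at `b` is its change from `a` to `b`, bounded by peeling, plus the error at
  -- `a`, bounded by Bernstein.
  have hdec : inner ℝ ((∫ z, G b z ∂μ) - (1 / (n : ℝ)) • ∑ i, G b (S i)) (b - a)
      = (1 / (n : ℝ)) * ((∑ k, ((∫ z, inner ℝ (G b z - G a z) (b - a) ∂μ)
          - inner ℝ (G b (S k) - G a (S k)) (b - a)))
        + inner ℝ (∑ k, ((∫ z, G a z ∂μ) - G a (S k))) (b - a)) := by
    rw [hmean]
    simp only [Finset.sum_sub_distrib, inner_sub_left, sum_inner, real_inner_smul_left,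
      Finset.sum_const, Finset.card_univ, Fintype.card_fin,
      ← Nat.cast_smul_eq_nsmul ℝ]
    field_simp
    ring
  have hb1 := huni b hb hd hdR
  have hb2 : inner ℝ (∑ k, ((∫ z, G a z ∂μ) - G a (S k))) (b - a)
      ≤ (2 * M * Real.log (2 / δ)
        + Real.sqrt (8 * n * (β * D ^ 2) * (∫ z, f a z ∂μ) * Real.log (2 / δ))) * ‖b - a‖ :=
    (real_inner_le_norm _ _).trans (by gcongr)
  have e1 : 1 / (n : ℝ) * (β * D ^ 2 * ‖b - a‖ ^ 2 * Real.sqrt n * complexityConst n R δ)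
      = β * D ^ 2 * complexityConst n R δ / Real.sqrt n * ‖b - a‖ ^ 2 := by
    have hsn : Real.sqrt n ^ 2 = n := Real.sq_sqrt hn'.le
    have hsn0 : 0 < Real.sqrt n := Real.sqrt_pos.2 hn'
    nth_rewrite 1 [← hsn]
    field_simp
  have e2 : Real.sqrt (8 * n * (β * D ^ 2) * (∫ z, f a z ∂μ) * Real.log (2 / δ))
      = n * Real.sqrt (8 * (β * D ^ 2) * (∫ z, f a z ∂μ) * Real.log (2 / δ) / n) := by
    nth_rewrite 2 [← Real.sqrt_sq hn'.le]
    rw [← Real.sqrt_mul (by positivity)]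
    congr 1
    field_simp
  rw [hdec]
  refine (mul_le_mul_of_nonneg_left (add_le_add hb1 hb2) (by positivity)).trans (le_of_eq ?_)
  rw [mul_add, e1, e2]
  field_simp

end IsSmoothLinearModel

end Peeling

/-! ### Solving the quadratic inequality in the distance. -/

section Arithmetic

/-- `d ≤ 2R` makes `A d²` linear in `d`; the `A` and `b` terms then each absorb `λ/4 d²`, while `m d
≤ 2 R m`. -/
lemma le_of_add_half_sq_le {X lam d A m b R : ℝ} (hlam : 0 < lam) (hd : 0 ≤ d) (hdR : d ≤ 2 * R)
    (hA : 0 ≤ A) (hm : 0 ≤ m) (h : X + lam / 2 * d ^ 2 ≤ A * d ^ 2 + (m + b) * d) :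
    X ≤ 4 * R ^ 2 * A ^ 2 / lam + 2 * R * m + b ^ 2 / lam := by
  have h1 : A * d ^ 2 ≤ 2 * R * A * d := by nlinarith [mul_nonneg hA hd]
  have h2 : 2 * R * A * d ≤ lam / 4 * d ^ 2 + 4 * R ^ 2 * A ^ 2 / lam := by
    have e : lam / 4 * d ^ 2 + 4 * R ^ 2 * A ^ 2 / lam - 2 * R * A * d
        = (lam / 2 * d - 2 * R * A) ^ 2 / lam := by field_simp; ring
    have : 0 ≤ (lam / 2 * d - 2 * R * A) ^ 2 / lam := by positivity
    linarith
  have h3 : b * d ≤ lam / 4 * d ^ 2 + b ^ 2 / lam := by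
    have e : lam / 4 * d ^ 2 + b ^ 2 / lam - b * d = (lam / 2 * d - b) ^ 2 / lam := by
      field_simp; ring
    have : 0 ≤ (lam / 2 * d - b) ^ 2 / lam := by positivity
    linarith
  have h4 : m * d ≤ 2 * R * m := by nlinarith
  linarith

/-- Here `A d²` uses half of `λ/2 d²`, which leaves `λ/8 d²` for each of `m` and `b`. -/
lemma le_of_add_half_sq_le_of_le {X lam d A m b : ℝ} (hlam : 0 < lam) (hA : A ≤ lam / 4)
    (h : X + lam / 2 * d ^ 2 ≤ A * d ^ 2 + (m + b) * d) :
    X ≤ 2 * m ^ 2 / lam + 2 * b ^ 2 / lam := by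
  have hsq : ∀ c : ℝ, c * d ≤ lam / 8 * d ^ 2 + 2 * c ^ 2 / lam := fun c => by
    have e : lam / 8 * d ^ 2 + 2 * c ^ 2 / lam - c * d = 2 * (lam / 4 * d - c) ^ 2 / lam := by
      field_simp; ring
    have : 0 ≤ 2 * (lam / 4 * d - c) ^ 2 / lam := by positivity
    linarith
  have h1 : A * d ^ 2 ≤ lam / 4 * d ^ 2 := by gcongr
  linarith [hsq m, hsq b]

end Arithmetic

/-! ### The concrete loss as a smooth linear model. -/

section LinearLoss

lemma isNonnegSmoothOn_iff {β a : ℝ} {f : ℝ → ℝ} : IsNonnegSmoothOn β a f ↔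
    ∃ g, NonnegSmooth β g ∧ ∀ u ∈ Set.Icc (-a) a, f u = g u := by
  constructor
  · rintro ⟨g, h1, h2, h3, h4⟩
    exact ⟨g, ⟨h1, h2, h3⟩, h4⟩
  · rintro ⟨g, ⟨h1, h2, h3⟩, h4⟩
    exact ⟨g, h1, h2, h3, h4⟩

variable {E : Type*} [NormedAddCommGroup E] [InnerProductSpace ℝ E]

lemma inner_mem_Icc_of_norm_le {w x : E} {D R : ℝ} (hx : ‖x‖ ≤ D) (hw : ‖w‖ ≤ R) :
    inner ℝ w x ∈ Set.Icc (-(D * R)) (D * R) := by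
  refine abs_le.1 ((abs_real_inner_le_norm w x).trans ?_)
  rw [mul_comm]
  exact mul_le_mul hx hw (norm_nonneg _) ((norm_nonneg _).trans hx)

lemma derivWithin_Icc_eq {f g : ℝ → ℝ} {a u : ℝ} (ha : 0 < a) (hg : Differentiable ℝ g)
    (hfg : ∀ u ∈ Set.Icc (-a) a, f u = g u) (hu : u ∈ Set.Icc (-a) a) :
    derivWithin f (Set.Icc (-a) a) u = deriv g u := by
  rw [derivWithin_congr hfg (hfg u hu)]
  exact (hg u).derivWithin (uniqueDiffOn_Icc (by linarith) u hu)

lemma isLinearLossAt_linLoss {ℓ : ℝ → ℝ → ℝ} {W : Set E} {β D R : ℝ} (hR : 0 < R)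
    (hWR : ∀ w ∈ W, ‖w‖ ≤ R) {z : E × ℝ} (hz : ‖z.1‖ ≤ D)
    (hs : IsNonnegSmoothOn β (D * R) fun u => ℓ u z.2) :
    IsLinearLossAt W β D z.1 (fun w => linLoss ℓ w z) fun w => linLossGrad ℓ (D * R) w z := by
  obtain ⟨g, hg, hfg⟩ := isNonnegSmoothOn_iff.1 hs
  refine ⟨hz, g, hg, fun w hw => ?_⟩
  have hu := inner_mem_Icc_of_norm_le hz (hWR w hw)
  refine ⟨hfg _ hu, ?_⟩
  change derivWithin (fun u => ℓ u z.2) _ _ • z.1 = _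
  -- For `D = 0` the interval is a point and the derivative within it carries no information, but
  -- then `x = 0`.
  rcases ((norm_nonneg _).trans hz).eq_or_lt with h0 | hpos
  · have : z.1 = 0 := norm_le_zero_iff.1 (hz.trans h0.ge)
    simp [this]
  · rw [derivWithin_Icc_eq (mul_pos hpos hR) hg.differentiable hfg hu]

variable [MeasurableSpace E] [BorelSpace E]

lemma aestronglyMeasurable_linLossGrad {μ : Measure (E × ℝ)}
    (hx : AEStronglyMeasurable (fun z : E × ℝ => z.1) μ) {ℓ : ℝ → ℝ → ℝ}
    (hℓ : Measurable (Function.uncurry ℓ)) {β D R : ℝ} (hR : 0 < R)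
    (hD : ∀ᵐ z ∂μ, ‖z.1‖ ≤ D) (hs : ∀ᵐ z ∂μ, IsNonnegSmoothOn β (D * R) fun u => ℓ u z.2)
    {w : E} (hw : ‖w‖ ≤ R) : AEStronglyMeasurable (linLossGrad ℓ (D * R) w) μ := by
  rcases le_or_gt D 0 with h0 | hpos
  · have hzero : ∀ᵐ z ∂μ, linLossGrad ℓ (D * R) w z = 0 := hD.mono fun z hz => by
      have : z.1 = 0 := norm_le_zero_iff.1 (hz.trans h0)
      simp [linLossGrad, this]
    exact (aestronglyMeasurable_const (b := (0 : E))).congr (hzero.mono fun z hz => hz.symm)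
  · refine AEStronglyMeasurable.smul (𝕜 := ℝ) (AEMeasurable.aestronglyMeasurable ?_) hx
    have ha : 0 < D * R := mul_pos hpos hR
    set a := D * R with hadef
    have hu : Measurable fun z : E × ℝ => (inner ℝ w z.1 : ℝ) :=
      (continuous_const.inner continuous_id).measurable.comp measurable_fst
    -- The loss is controlled only on `[-a, a]`, so the difference quotients that show measurability
    -- step towards zero; a step of size at most `a` stays in the interval.
    let η : ℕ → E × ℝ → ℝ := fun k z =>
      if inner ℝ w z.1 ≤ (0 : ℝ) then a / ((k : ℝ) + 1) else -(a / ((k : ℝ) + 1))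
    have hη : ∀ k, Measurable (η k) := fun k =>
      Measurable.ite (measurableSet_le hu measurable_const) measurable_const measurable_const
    have hq : ∀ k, Measurable fun z : E × ℝ =>
        (η k z)⁻¹ * (ℓ (inner ℝ w z.1 + η k z) z.2 - ℓ (inner ℝ w z.1) z.2) := fun k =>
      (hη k).inv.mul ((hℓ.comp ((hu.add (hη k)).prodMk measurable_snd)).sub
        (hℓ.comp (hu.prodMk measurable_snd)))
    refine aemeasurable_of_tendsto_metrizable_ae Filter.atTop (fun k => (hq k).aemeasurable) ?_
    filter_upwards [hD, hs] with z hz hsz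
    obtain ⟨g, hg, hfg⟩ := isNonnegSmoothOn_iff.1 hsz
    have huz : inner ℝ w z.1 ∈ Set.Icc (-a) a := inner_mem_Icc_of_norm_le hz hw
    rw [derivWithin_Icc_eq ha hg.differentiable hfg huz]
    have hk : ∀ k : ℕ, 0 < a / ((k : ℝ) + 1) ∧ a / ((k : ℝ) + 1) ≤ a := fun k => by
      refine ⟨by positivity, div_le_self ha.le ?_⟩
      linarith [(Nat.cast_nonneg k : (0 : ℝ) ≤ k)]
    have hmem : ∀ k, inner ℝ w z.1 + η k z ∈ Set.Icc (-a) a := fun k => by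
      obtain ⟨h1, h2⟩ := hk k
      obtain ⟨h3, h4⟩ := huz
      simp only [η]
      split_ifs with h
      · constructor <;> linarith
      · have := not_le.1 h
        constructor <;> linarith
    have hne : ∀ k, η k z ≠ 0 := fun k => by
      have := (hk k).1
      simp only [η]
      split_ifs
      · exact this.ne'
      · exact (neg_neg_of_pos this).ne
    have hlim : Filter.Tendsto (fun k => η k z) Filter.atTop (nhdsWithin 0 {0}ᶜ) := by
      refine tendsto_nhdsWithin_iff.2 ⟨?_, Filter.Eventually.of_forall hne⟩
      have h0 : Filter.Tendsto (fun k : ℕ => a / ((k : ℝ) + 1)) Filter.atTop (nhds 0) :=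
        tendsto_const_div_atTop_nhds_zero_nat a |>.comp (Filter.tendsto_add_atTop_nat 1) |>.congr
          fun k => by simp
      simp only [η]
      split_ifs
      · exact h0
      · simpa using h0.neg
    refine ((hasDerivAt_iff_tendsto_slope_zero.1
      (hg.differentiable (inner ℝ w z.1)).hasDerivAt).comp hlim).congr fun k => ?_
    have h1 : ℓ (inner ℝ w z.1 + η k z) z.2 = g (inner ℝ w z.1 + η k z) := hfg _ (hmem k)
    have h2 : ℓ (inner ℝ w z.1) z.2 = g (inner ℝ w z.1) := hfg _ huz
    simp only [Function.comp_apply, smul_eq_mul, h1, h2]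

end LinearLoss

/-! ### The risk bounds on the typical event. -/

lemma withProbAtLeast_of_measure_compl_le {Ω : Type*} [MeasurableSpace Ω] {P : Measure Ω}
    [IsProbabilityMeasure P] {A : Set Ω} {q : ℝ} (hq : 0 ≤ q) (h : P Aᶜ ≤ ENNReal.ofReal q) :
    WithProbAtLeast P (1 - q) A := by
  refine ⟨(toMeasurable P Aᶜ)ᶜ, (measurableSet_toMeasurable _ _).compl, ?_, ?_⟩
  · rw [Set.compl_subset_comm]
    exact subset_toMeasurable _ _
  · rw [prob_compl_eq_one_sub (measurableSet_toMeasurable _ _), measure_toMeasurable,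
      ENNReal.ofReal_sub _ hq, ENNReal.ofReal_one]
    exact tsub_le_tsub_left h 1

lemma WithProbAtLeast.mono {Ω : Type*} [MeasurableSpace Ω] {P : Measure Ω} {p : ℝ} {A A' : Set Ω}
    (h : WithProbAtLeast P p A) (hA : A ⊆ A') : WithProbAtLeast P p A' := by
  obtain ⟨B, hB, hBA, hp⟩ := h
  exact ⟨B, hB, hBA.trans hA, hp⟩

theorem theorem5
    {E : Type*} [NormedAddCommGroup E] [InnerProductSpace ℝ E] [CompleteSpace E]
    [MeasurableSpace E] [BorelSpace E]
    -- the distribution of `(x, y)`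
    (μ : Measure (E × ℝ)) [IsProbabilityMeasure μ]
    (hx : AEStronglyMeasurable (fun z : E × ℝ => z.1) μ)
    -- the domain
    (W : Set E) (hWconv : Convex ℝ W) (R : ℝ) (hR : 0 < R) (hWR : ∀ w ∈ W, ‖w‖ ≤ R)
    -- the data are bounded
    (D : ℝ) (hD : ∀ᵐ z ∂μ, ‖z.1‖ ≤ D)
    -- the loss
    (ℓ : ℝ → ℝ → ℝ) (hℓ : Measurable (Function.uncurry ℓ))
    (β : ℝ) (hβ : 0 ≤ β)
    (hsmooth : ∀ᵐ z ∂μ, IsNonnegSmoothOn β (D * R) (fun u => ℓ u z.2))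
    (hint : ∀ w ∈ W, Integrable (linLoss ℓ w) μ)
    -- the regularizer
    (r : E → ℝ) (P : ℝ) (hP : 0 ≤ P)
    (hr : ∀ w ∈ W, ∀ w' ∈ W, |r w - r w'| ≤ P * ‖w - w'‖)
    -- the number of training examples
    (n : ℕ) (hn : 0 < n)
    -- convexity of the expected and of the empirical objective
    (lam : ℝ) (hlam : 0 < lam)
    (hF : StrongConvexOn W lam (risk ℓ r μ))
    (hFhat : ∀ᵐ S ∂(Measure.pi fun _ : Fin n => μ), ConvexOn ℝ W (empRisk ℓ r S))
    -- the optimal solution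
    (wstar : E) (hwW : wstar ∈ W) (hwmin : IsMinOn (risk ℓ r μ) W wstar)
    -- the quantities in the bounds
    (δ : ℝ) (hδ0 : 0 < δ) (hδ1 : δ < 1)
    (M : ℝ) (hM0 : 0 ≤ M)
    (hM : essSup (fun z => ‖linLossGrad ℓ (D * R) wstar z‖ₑ) μ = ENNReal.ofReal M)
    (C : ℝ) (hC : C = complexityConst n R δ)
    (Hstar : ℝ) (hHstar : Hstar = expLoss ℓ μ wstar)
    (L : ℝ) (hL : L = β * D ^ 2)
    (κ : ℝ) (hκ : κ = L / lam) :
    WithProbAtLeast (Measure.pi fun _ : Fin n => μ) (1 - 2 * δ)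
      {S | ∀ what ∈ W, IsMinOn (empRisk ℓ r S) W what →
        risk ℓ r μ what - risk ℓ r μ wstar ≤
          max ((M + P) / (n : ℝ) ^ 2 + L / (2 * (n : ℝ) ^ 4))
            (4 * R ^ 2 * L ^ 2 * C ^ 2 / (lam * n) + 4 * R * M * Real.log (2 / δ) / n
              + 8 * L * Hstar * Real.log (2 / δ) / (lam * n))} ∧
    (16 * κ ^ 2 * C ^ 2 ≤ (n : ℝ) →
      WithProbAtLeast (Measure.pi fun _ : Fin n => μ) (1 - 2 * δ)
        {S | ∀ what ∈ W, IsMinOn (empRisk ℓ r S) W what →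
          risk ℓ r μ what - risk ℓ r μ wstar ≤
            max ((M + P) / (n : ℝ) ^ 2 + L / (2 * (n : ℝ) ^ 4))
              (8 * M ^ 2 * Real.log (2 / δ) ^ 2 / (lam * (n : ℝ) ^ 2)
                + 16 * L * Hstar * Real.log (2 / δ) / (lam * n))}) := by
  subst hC hHstar hL hκ
  set τ := Real.log (2 / δ) with hτdef
  set C := complexityConst n R δ with hCdef
  set H := expLoss ℓ μ wstar with hHdef
  set T := {S : Fin n → E × ℝ | IsSmoothLinearModel.Typical μ W β D (fun z => z.1) (linLoss ℓ)
    (linLossGrad ℓ (D * R)) wstar M R δ n S} with hT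
  have hmodel : IsSmoothLinearModel μ W β D (fun z => z.1) (linLoss ℓ) (linLossGrad ℓ (D * R)) :=
    ⟨hx, fun w hw => aestronglyMeasurable_linLossGrad hx hℓ hR hD hsmooth (hWR w hw), hint, by
      filter_upwards [hD, hsmooth] with z hz hsz
      exact isLinearLossAt_linLoss hR hWR hz hsz⟩
  have hMae : ∀ᵐ z ∂μ, ‖linLossGrad ℓ (D * R) wstar z‖ ≤ M := by
    filter_upwards [ae_le_essSup (μ := μ) (f := fun z => ‖linLossGrad ℓ (D * R) wstar z‖ₑ)]
      with z hz
    rw [hM, ← ofReal_norm, ENNReal.ofReal_le_ofReal_iff hM0] at hz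
    exact hz
  have hprob : WithProbAtLeast (Measure.pi fun _ : Fin n => μ) (1 - 2 * δ) T :=
    withProbAtLeast_of_measure_compl_le (by positivity)
      (hmodel.measure_not_typical_le hβ hwW hM0 hMae hn R hδ0 hδ1)
  have hn' : (0 : ℝ) < n := by exact_mod_cast hn
  have hτ : 0 ≤ τ := by
    refine Real.log_nonneg ?_
    rw [le_div_iff₀ hδ0]
    linarith
  have hC0 : 0 ≤ C := complexityConst_nonneg n R δ
  have hL0 : 0 ≤ β * D ^ 2 := by positivity
  have hH0 : 0 ≤ H := integral_nonneg_of_ae (hmodel.spec.mono fun z hz => hz.nonneg hwW)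
  have hA2 : (β * D ^ 2 * C / Real.sqrt n) ^ 2 = (β * D ^ 2) ^ 2 * C ^ 2 / n := by
    rw [div_pow, mul_pow, Real.sq_sqrt hn'.le]
  have hb2 : Real.sqrt (8 * (β * D ^ 2) * H * τ / n) ^ 2 = 8 * (β * D ^ 2) * H * τ / n :=
    Real.sq_sqrt (by positivity)
  have hA0 : 0 ≤ β * D ^ 2 * C / Real.sqrt n := by positivity
  have hm0 : 0 ≤ 2 * M * τ / n := by positivity
  have hdR : ∀ b ∈ W, ‖b - wstar‖ ≤ 2 * R := fun b hb =>
    (norm_sub_le _ _).trans (by linarith [hWR b hb, hWR wstar hwW])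
  -- Inside the ball left out by peeling, the bound is deterministic: the mean gradient at `wstar`
  -- has norm at most `M`, and `r` contributes `P`.
  have hsmall : ∀ b ∈ W, ‖b - wstar‖ ≤ 1 / (n : ℝ) ^ 2 →
      risk ℓ r μ b - risk ℓ r μ wstar
        ≤ (M + P) / (n : ℝ) ^ 2 + β * D ^ 2 / (2 * (n : ℝ) ^ 4) := by
    intro b hb hd
    have h1 := (abs_le.1 (hmodel.abs_integral_sub_sub_le hβ hb hwW)).2
    have h2 : inner ℝ (∫ z, linLossGrad ℓ (D * R) wstar z ∂μ) (b - wstar) ≤ M * ‖b - wstar‖ :=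
      (real_inner_le_norm _ _).trans
        (mul_le_mul_of_nonneg_right (norm_integral_le_of_ae_le hMae) (norm_nonneg _))
    have h3 := (le_abs_self _).trans (hr b hb wstar hwW)
    calc risk ℓ r μ b - risk ℓ r μ wstar
        ≤ (M + P) * ‖b - wstar‖ + β * D ^ 2 / 2 * ‖b - wstar‖ ^ 2 := by
          simp only [risk, expLoss]
          linarith
      _ ≤ (M + P) * (1 / (n : ℝ) ^ 2) + β * D ^ 2 / 2 * (1 / (n : ℝ) ^ 2) ^ 2 := by gcongr
      _ = _ := by field_simp
  have hlarge : ∀ S ∈ T, ∀ b ∈ W, IsMinOn (empRisk ℓ r S) W b →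
      1 / (n : ℝ) ^ 2 < ‖b - wstar‖ →
      risk ℓ r μ b - risk ℓ r μ wstar + lam / 2 * ‖b - wstar‖ ^ 2
        ≤ β * D ^ 2 * C / Real.sqrt n * ‖b - wstar‖ ^ 2
          + (2 * M * τ / n + Real.sqrt (8 * (β * D ^ 2) * H * τ / n)) * ‖b - wstar‖ :=
    fun S hS b hb hmin hd => hS.excess_risk_le hmodel hβ hwW hn hlam.le hF hb hmin hd (hdR b hb)
  refine ⟨hprob.mono fun S hS b hb hmin => ?_, fun hnκ => hprob.mono fun S hS b hb hmin => ?_⟩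
  · rcases le_or_gt ‖b - wstar‖ (1 / (n : ℝ) ^ 2) with hd | hd
    · exact (hsmall b hb hd).trans (le_max_left _ _)
    · refine (le_of_add_half_sq_le hlam (norm_nonneg _) (hdR b hb) hA0 hm0
        (hlarge S hS b hb hmin hd)).trans (le_trans (le_of_eq ?_) (le_max_right _ _))
      rw [hA2, hb2]
      field_simp
      ring
  · rcases le_or_gt ‖b - wstar‖ (1 / (n : ℝ) ^ 2) with hd | hd
    · exact (hsmall b hb hd).trans (le_max_left _ _)
    · have hA : β * D ^ 2 * C / Real.sqrt n ≤ lam / 4 := by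
        refine (pow_le_pow_iff_left₀ hA0 (by positivity) two_ne_zero).1 ?_
        rw [hA2, div_le_iff₀ hn']
        have h1 := mul_le_mul_of_nonneg_left hnκ (by positivity : 0 ≤ (lam / 4) ^ 2)
        refine le_of_eq_of_le ?_ h1
        field_simp
        ring
      refine (le_of_add_half_sq_le_of_le hlam hA (hlarge S hS b hb hmin hd)).trans
        (le_trans (le_of_eq ?_) (le_max_right _ _))
      rw [hb2]
      field_simp
      ring
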